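/- Let $(M,g)$ be a smooth finite-dimensional Riemannian manifold with Levi-Civita connection $\nabla$, and let $p\in M$ be a pole, i.e. the exponential map $\exp_p:T_pM\to M$ is defined on all of $T_pM$ and is a diffeomorphism. Let $K\ge 0$ and suppose that the radial sectional curvature of $M$ with respect to $p$ is bounded below by $-K^2$: for every $x\neq p$, every plane $\pi\subset T_xM$ containing the unit tangent vector at $x$ of the geodesic from $p$ to $x$ has sectional curvature at least $-K^2$. Let $\rho(x)=d(p,x)$ be the Riemannian distance from $p$, and let $H(f)(X,Y)=X(Yf)-(\nabla_XY)f$ denote the Hessian of a function $f$. Then $\rho$ is smooth at every point $x\in M\setminus\{p\}$, and for every such $x$ and every unit vector $u\in T_xM$, $$H(\rho)(u,u)\le\frac1{\rho(x)}+K .$$ -/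

import Mathlib

open Bundle Manifold VectorField FiberBundle
open scoped ContDiff

set_option linter.unusedSectionVars false

noncomputable section
namespace RiemannGeom

variable {E : Type*} [NormedAddCommGroup E] [NormedSpace ℝ E] [FiniteDimensional ℝ E]
  {M : Type*} [TopologicalSpace M] [ChartedSpace E M] [IsManifold 𝓘(ℝ, E) ∞ M]
  [RiemannianBundle (fun x : M ↦ TangentSpace 𝓘(ℝ, E) x)]

/-- The Koszul expression, i.e. the value of `⟪∇_X Y, Z⟫` at `x` for the Levi-Civita connection:
half of `X⟪Y,Z⟫ + Y⟪Z,X⟫ - Z⟪X,Y⟫ + ⟪[X,Y],Z⟫ - ⟪[Y,Z],X⟫ + ⟪[Z,X],Y⟫`. -/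
def koszul (X Y Z : (x : M) → TangentSpace 𝓘(ℝ, E) x) (x : M) : ℝ :=
  (mvfderiv 𝓘(ℝ, E) (fun y ↦ inner ℝ (Y y) (Z y)) x (X x)
    + mvfderiv 𝓘(ℝ, E) (fun y ↦ inner ℝ (Z y) (X y)) x (Y x)
    - mvfderiv 𝓘(ℝ, E) (fun y ↦ inner ℝ (X y) (Y y)) x (Z x)
    + inner ℝ (mlieBracket 𝓘(ℝ, E) X Y x) (Z x)
    - inner ℝ (mlieBracket 𝓘(ℝ, E) Y Z x) (X x)
    + inner ℝ (mlieBracket 𝓘(ℝ, E) Z X x) (Y x)) / 2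

variable [IsContMDiffRiemannianBundle 𝓘(ℝ, E) ∞ E (fun x : M ↦ TangentSpace 𝓘(ℝ, E) x)]

theorem completeSpace_model (E : Type*) [NormedAddCommGroup E] [NormedSpace ℝ E]
    [FiniteDimensional ℝ E] : CompleteSpace E := FiniteDimensional.complete ℝ E

attribute [local instance] completeSpace_model

theorem mdiff_inner {X Y : (x : M) → TangentSpace 𝓘(ℝ, E) x} {x : M}
    (hX : MDiffAt (T% X) x) (hY : MDiffAt (T% Y) x) :
    MDifferentiableAt 𝓘(ℝ, E) 𝓘(ℝ) (fun y ↦ (inner ℝ (X y) (Y y) : ℝ)) x :=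
  MDifferentiableAt.inner_bundle (E := fun x : M ↦ TangentSpace 𝓘(ℝ, E) x) hX hY

theorem tensorialX (Y Z : (x : M) → TangentSpace 𝓘(ℝ, E) x) (x : M)
  (hY : MDiffAt (T% Y) x) (hZ : MDiffAt (T% Z) x) :
    TensorialAt 𝓘(ℝ, E) E (koszul · Y Z x) x where
  smul {f X} hf hX := by
    have h1 := mvfderiv_fun_mul hf (mdiff_inner hZ hX)
    have h2 := mvfderiv_fun_mul hf (mdiff_inner hX hY)
    simp [koszul, inner_smul_left, inner_smul_right, h1, h2, mlieBracket_smul_left hf hX,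
      mlieBracket_smul_right hf hX, inner_add_left]
    rw [real_inner_comm (X x) (Z x)]
    ring
  add {X X'} hX hX' := by
    have h1 := mvfderiv_fun_add (mdiff_inner hZ hX) (mdiff_inner hZ hX')
    have h2 := mvfderiv_fun_add (mdiff_inner hX hY) (mdiff_inner hX' hY)
    simp [koszul, inner_add_left, inner_add_right, h1, h2, mlieBracket_add_left hX hX',
      mlieBracket_add_right hX hX']
    ring

theorem tensorialZ (X Y : (x : M) → TangentSpace 𝓘(ℝ, E) x) (x : M)
  (hX : MDiffAt (T% X) x) (hY : MDiffAt (T% Y) x) :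
    TensorialAt 𝓘(ℝ, E) E (koszul X Y · x) x where
  smul {f Z} hf hZ := by
    have h1 := mvfderiv_fun_mul hf (mdiff_inner hY hZ)
    have h2 := mvfderiv_fun_mul hf (mdiff_inner hZ hX)
    simp [koszul, inner_smul_left, inner_smul_right, h1, h2, mlieBracket_smul_left hf hZ,
      mlieBracket_smul_right hf hZ, inner_add_left]
    rw [real_inner_comm (Y x) (Z x)]
    ring
  add {Z Z'} hZ hZ' := by
    have h1 := mvfderiv_fun_add (mdiff_inner hY hZ) (mdiff_inner hY hZ')
    have h2 := mvfderiv_fun_add (mdiff_inner hZ hX) (mdiff_inner hZ' hX)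
    simp [koszul, inner_add_left, inner_add_right, h1, h2, mlieBracket_add_left hZ hZ',
      mlieBracket_add_right hZ hZ']
    ring

theorem koszul_add (X Y Y' Z : (x : M) → TangentSpace 𝓘(ℝ, E) x) (x : M)
    (hX : MDiffAt (T% X) x) (hY : MDiffAt (T% Y) x) (hY' : MDiffAt (T% Y') x)
    (hZ : MDiffAt (T% Z) x) : koszul X (Y + Y') Z x = koszul X Y Z x + koszul X Y' Z x := by
  have h1 := mvfderiv_fun_add (mdiff_inner hY hZ) (mdiff_inner hY' hZ)
  have h2 := mvfderiv_fun_add (mdiff_inner hX hY) (mdiff_inner hX hY')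
  simp [koszul, inner_add_left, inner_add_right, h1, h2, mlieBracket_add_left hY hY',
      mlieBracket_add_right hY hY']
  ring

theorem koszul_smul (X Y Z : (x : M) → TangentSpace 𝓘(ℝ, E) x) (f : M → ℝ) (x : M)
    (hX : MDiffAt (T% X) x) (hY : MDiffAt (T% Y) x) (hf : MDiffAt f x)
    (hZ : MDiffAt (T% Z) x) : koszul X (f • Y) Z x =
      f x * koszul X Y Z x + mvfderiv 𝓘(ℝ, E) f x (X x) * inner ℝ (Y x) (Z x) := by
  have h1 := mvfderiv_fun_mul hf (mdiff_inner hY hZ)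
  have h2 := mvfderiv_fun_mul hf (mdiff_inner hX hY)
  simp [koszul, inner_smul_left, inner_smul_right, h1, h2, mlieBracket_smul_left hf hY,
      mlieBracket_smul_right hf hY, inner_add_left]
  rw [real_inner_comm (X x) (Y x)]
  ring

theorem koszul_torsion (X Y Z : (x : M) → TangentSpace 𝓘(ℝ, E) x) (x : M) :
    koszul X Y Z x - koszul Y X Z x = inner ℝ (mlieBracket 𝓘(ℝ, E) X Y x) (Z x) := by
  have h1 : mlieBracket 𝓘(ℝ, E) Y X = - mlieBracket 𝓘(ℝ, E) X Y := mlieBracket_swap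
  have h2 : mlieBracket 𝓘(ℝ, E) Z X = - mlieBracket 𝓘(ℝ, E) X Z := mlieBracket_swap
  have h3 : mlieBracket 𝓘(ℝ, E) Z Y = - mlieBracket 𝓘(ℝ, E) Y Z := mlieBracket_swap
  have c (A B : (x : M) → TangentSpace 𝓘(ℝ, E) x) :
    (fun y ↦ (inner ℝ (A y) (B y) : ℝ)) = fun y ↦ inner ℝ (B y) (A y) := by
      ext y; exact real_inner_comm _ _
  simp only [koszul, h1, h2, h3, c Y X, c Z X, c Z Y, Pi.neg_apply, inner_neg_left]
  ring

theorem koszul_metric (X Y Z : (x : M) → TangentSpace 𝓘(ℝ, E) x) (x : M) :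
    koszul X Y Z x + koszul X Z Y x =
      mvfderiv 𝓘(ℝ, E) (fun y ↦ inner ℝ (Y y) (Z y)) x (X x) := by
  have h1 : mlieBracket 𝓘(ℝ, E) Y X = - mlieBracket 𝓘(ℝ, E) X Y := mlieBracket_swap
  have h2 : mlieBracket 𝓘(ℝ, E) Z X = - mlieBracket 𝓘(ℝ, E) X Z := mlieBracket_swap
  have h3 : mlieBracket 𝓘(ℝ, E) Z Y = - mlieBracket 𝓘(ℝ, E) Y Z := mlieBracket_swap
  have c (A B : (x : M) → TangentSpace 𝓘(ℝ, E) x) :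
    (fun y ↦ (inner ℝ (A y) (B y) : ℝ)) = fun y ↦ inner ℝ (B y) (A y) := by
      ext y; exact real_inner_comm _ _
  simp only [koszul, h1, h2, h3, c Y X, c Z X, c Z Y, Pi.neg_apply, inner_neg_left]
  ring


open Classical in
/-- The map `v ↦ ∇_v Y` at `x`, obtained from the Koszul expression (which is tensorial in `X` and
`Z`) by Riesz duality. The value is irrelevant where `Y` is not differentiable. -/
def leviCivitaAux (Y : (x : M) → TangentSpace 𝓘(ℝ, E) x) (x : M) :
    TangentSpace 𝓘(ℝ, E) x →L[ℝ] TangentSpace 𝓘(ℝ, E) x :=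
  haveI : FiniteDimensional ℝ (TangentSpace 𝓘(ℝ, E) x) := inferInstanceAs (FiniteDimensional ℝ E)
  if hY : MDiffAt (T% Y) x then
    (InnerProductSpace.toDual ℝ
        (TangentSpace 𝓘(ℝ, E) x)).symm.toContinuousLinearEquiv.toContinuousLinearMap ∘L
      (TensorialAt.mkHom₂ (fun X Z ↦ koszul X Y Z x) x
        (fun Z hZ ↦ tensorialX Y Z x hY hZ) (fun X hX ↦ tensorialZ X Y x hX hY))
  else 0

theorem inner_leviCivitaAux {X Y Z : (x : M) → TangentSpace 𝓘(ℝ, E) x} {x : M}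
    (hX : MDiffAt (T% X) x) (hY : MDiffAt (T% Y) x) (hZ : MDiffAt (T% Z) x) :
    inner ℝ (leviCivitaAux Y x (X x)) (Z x) = koszul X Y Z x := by
  have : FiniteDimensional ℝ (TangentSpace 𝓘(ℝ, E) x) := inferInstanceAs (FiniteDimensional ℝ E)
  rw [leviCivitaAux, dif_pos hY]
  have := TensorialAt.mkHom₂_apply (Φ := fun X Z ↦ koszul X Y Z x) (x := x)
    (fun Z hZ ↦ tensorialX Y Z x hY hZ) (fun X hX ↦ tensorialZ X Y x hX hY) hX hZ
  rw [← this]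
  exact InnerProductSpace.toDual_symm_apply

theorem ext_inner_extend {x : M} {A B : TangentSpace 𝓘(ℝ, E) x}
    (h : ∀ Z : (x : M) → TangentSpace 𝓘(ℝ, E) x, MDiffAt (T% Z) x →
      (inner ℝ A (Z x) : ℝ) = inner ℝ B (Z x)) : A = B := by
  refine ext_inner_right ℝ fun z ↦ ?_
  have := h (extend E z) (mdifferentiableAt_extend ..)
  simpa using this

variable (E M) in
/-- The Levi-Civita connection of the Riemannian metric; `leviCivita E M Y x v` is `(∇_v Y)(x)`. -/
def leviCivita : CovariantDerivative 𝓘(ℝ, E) E (fun x : M ↦ TangentSpace 𝓘(ℝ, E) x) where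
  toFun := leviCivitaAux
  isCovariantDerivativeOnUniv :=
    { add := by
        intro Y Y' x hY hY' _
        ext1 v
        refine ext_inner_extend fun Z hZ ↦ ?_
        have hX : MDiffAt (T% (extend E v)) x := mdifferentiableAt_extend ..
        have h1 := inner_leviCivitaAux hX hY hZ
        have h2 := inner_leviCivitaAux hX hY' hZ
        have h3 := inner_leviCivitaAux hX (mdifferentiableAt_add_section hY hY') hZ
        have h4 := koszul_add _ _ _ _ x hX hY hY' hZ
        simp only [extend_apply_self] at h1 h2 h3
        rw [h3, h4, add_apply, inner_add_left, h1, h2]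
      leibniz := by
        intro Y f x hY hf _
        ext1 v
        refine ext_inner_extend fun Z hZ ↦ ?_
        have hX : MDiffAt (T% (extend E v)) x := mdifferentiableAt_extend ..
        have h1 := inner_leviCivitaAux hX hY hZ
        have h3 := inner_leviCivitaAux hX (hf.smul_section hY) hZ
        have h4 := koszul_smul _ _ _ f x hX hY hf hZ
        simp only [extend_apply_self] at h1 h3 h4
        rw [h3, h4, ← h1]
        simp [inner_add_left, inner_smul_left] }

theorem inner_leviCivita {X Y Z : (x : M) → TangentSpace 𝓘(ℝ, E) x} {x : M}
    (hX : MDiffAt (T% X) x) (hY : MDiffAt (T% Y) x) (hZ : MDiffAt (T% Z) x) :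
    inner ℝ (leviCivita E M Y x (X x)) (Z x) = koszul X Y Z x := inner_leviCivitaAux hX hY hZ

/-- The Levi-Civita connection is torsion free. -/
theorem leviCivita_torsion : (leviCivita E M).torsion = 0 := by
  rw [CovariantDerivative.torsion_eq_zero_iff]
  intro X Y x hX hY
  refine ext_inner_extend fun Z hZ ↦ ?_
  rw [inner_sub_left, inner_leviCivita hX hY hZ, inner_leviCivita hY hX hZ, koszul_torsion]

/-- The Levi-Civita connection is compatible with the metric. -/
theorem leviCivita_metric {X Y Z : (x : M) → TangentSpace 𝓘(ℝ, E) x} {x : M}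
    (hX : MDiffAt (T% X) x) (hY : MDiffAt (T% Y) x) (hZ : MDiffAt (T% Z) x) :
    mvfderiv 𝓘(ℝ, E) (fun y ↦ inner ℝ (Y y) (Z y)) x (X x) =
      inner ℝ (leviCivita E M Y x (X x)) (Z x) + inner ℝ (Y x) (leviCivita E M Z x (X x)) := by
  rw [inner_leviCivita hX hY hZ, real_inner_comm, inner_leviCivita hX hZ hY, koszul_metric]

/-- The velocity `γ'(t)` of a curve. -/
def velocity (γ : ℝ → M) (t : ℝ) : TangentSpace 𝓘(ℝ, E) (γ t) :=
  mfderiv 𝓘(ℝ, ℝ) 𝓘(ℝ, E) γ t (1 : ℝ)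

/-- The covariant derivative `(D V / dt)(t)` of a vector field `V` along a curve `γ`. In the local frame
`e₁, …, eₙ` given by the preferred trivialization at `γ t`, write `V(s) = ∑ Vⁱ(s) eᵢ(γ s)`; then
`D V / dt = ∑ (dVⁱ/dt) eᵢ + ∇_{γ'(t)} (∑ Vⁱ(t) eᵢ)`, and `extend E (V t)` is, near `γ t`, the field
`∑ Vⁱ(t) eᵢ` with frozen coefficients. -/
def covDerivAlong (γ : ℝ → M) (V : (t : ℝ) → TangentSpace 𝓘(ℝ, E) (γ t)) (t : ℝ) :
    TangentSpace 𝓘(ℝ, E) (γ t) :=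
  let e := trivializationAt E (fun x : M ↦ TangentSpace 𝓘(ℝ, E) x) (γ t)
  e.symm (γ t) (deriv (fun s ↦ (e ⟨γ s, V s⟩).2) t)
    + leviCivita E M (extend E (V t)) (γ t) (velocity γ t)

variable (E) in
/-- A (complete) geodesic: a smooth curve `γ : ℝ → M` with `D γ' / dt = 0`. -/
structure IsGeodesic (γ : ℝ → M) : Prop where
  contMDiff : ContMDiff 𝓘(ℝ, ℝ) 𝓘(ℝ, E) ∞ γ
  covDerivAlong_velocity : ∀ t, covDerivAlong γ (velocity (E := E) γ) t = 0

/-- `e : T_pM → M` is the exponential map at `p`: for every `v`, the curve `t ↦ e (t v)` is the geodesic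
with initial point `p` and initial velocity `v`. -/
def IsExpMapAt (p : M) (e : TangentSpace 𝓘(ℝ, E) p → M) : Prop :=
  ∀ v : TangentSpace 𝓘(ℝ, E) p, IsGeodesic E (fun t : ℝ ↦ e (t • v)) ∧
    (⟨e ((0 : ℝ) • v), velocity (fun t : ℝ ↦ e (t • v)) 0⟩ : TangentBundle 𝓘(ℝ, E) M) = ⟨p, v⟩

variable (E) in
/-- `p` is a pole: the exponential map at `p` is defined on all of `T_pM` and is a diffeomorphism onto
`M`. -/
def IsPole (p : M) : Prop :=
  ∃ e : Diffeomorph 𝓘(ℝ, TangentSpace 𝓘(ℝ, E) p) 𝓘(ℝ, E) (TangentSpace 𝓘(ℝ, E) p) M ∞,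
    IsExpMapAt p e

/-- The curvature `R(X,Y)Z = ∇_X ∇_Y Z - ∇_Y ∇_X Z - ∇_[X,Y] Z` on vector fields. -/
def curvatureField (X Y Z : (x : M) → TangentSpace 𝓘(ℝ, E) x) (x : M) :
    TangentSpace 𝓘(ℝ, E) x :=
  leviCivita E M (fun y ↦ leviCivita E M Z y (Y y)) x (X x)
    - leviCivita E M (fun y ↦ leviCivita E M Z y (X y)) x (Y x)
    - leviCivita E M Z x (mlieBracket 𝓘(ℝ, E) X Y x)

/-- The Riemann curvature tensor `R(u,v)w` at `x`, by extending the vectors to smooth local fields. -/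
def curvature (x : M) (u v w : TangentSpace 𝓘(ℝ, E) x) : TangentSpace 𝓘(ℝ, E) x :=
  curvatureField (extend E u) (extend E v) (extend E w) x

/-- The sectional curvature `⟪R(u,v)v,u⟫ / (|u|²|v|² - ⟪u,v⟫²)` of the plane spanned by `u` and `v`. -/
def sectionalCurvature (x : M) (u v : TangentSpace 𝓘(ℝ, E) x) : ℝ :=
  inner ℝ (curvature x u v v) u / (‖u‖ ^ 2 * ‖v‖ ^ 2 - (inner ℝ u v) ^ 2)

/-- The Hessian `H(f)(X,Y) = X(Yf) - (∇_X Y)f` on vector fields. -/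
def hessianField (f : M → ℝ) (X Y : (x : M) → TangentSpace 𝓘(ℝ, E) x) (x : M) : ℝ :=
  mvfderiv 𝓘(ℝ, E) (fun y ↦ mvfderiv 𝓘(ℝ, E) f y (Y y)) x (X x)
    - mvfderiv 𝓘(ℝ, E) f x (leviCivita E M Y x (X x))

/-- The Hessian `H(f)(u,v)` on tangent vectors at `x`, by extending them to smooth local fields. -/
def hessian (f : M → ℝ) (x : M) (u v : TangentSpace 𝓘(ℝ, E) x) : ℝ :=
  hessianField f (extend E u) (extend E v) x

/-- `τ ∈ T_xM` is a radial vector: it is the velocity at `x` of a unit-speed geodesic that starts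
at `p` and reaches `x` after a positive time. -/
def IsRadialVector (p x : M) (τ : TangentSpace 𝓘(ℝ, E) x) : Prop :=
  ∃ (γ : ℝ → M) (r : ℝ), IsGeodesic E γ ∧
    (∀ t, ‖(velocity γ t : TangentSpace 𝓘(ℝ, E) (γ t))‖ = 1) ∧ 0 < r ∧ γ 0 = p ∧
      (⟨γ r, velocity γ r⟩ : TangentBundle 𝓘(ℝ, E) M) = ⟨x, τ⟩

variable (E) in
/-- The radial sectional curvature with respect to `p` is at least `c`: the sectional curvature of
every plane at a point `x ≠ p` that contains the radial vector is at least `c`. -/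
def RadialCurvatureGE (p : M) (c : ℝ) : Prop :=
  ∀ (x : M) (τ w : TangentSpace 𝓘(ℝ, E) x), x ≠ p → IsRadialVector p x τ →
    LinearIndependent ℝ ![τ, w] → c ≤ sectionalCurvature x τ w

variable (E) in
/-- The Riemannian distance `ρ(x) = d(p,x)`, the infimum of the lengths of `C¹` curves from `p` to `x`. -/
def distFrom (p x : M) : ℝ := (riemannianEDist 𝓘(ℝ, E) p x).toReal

end RiemannGeom

end

/-!
Write `Φ = exp_p`, a diffeomorphism from the inner product space `V = T_pM` onto `M`, so that rays
`t ↦ Φ (t • v)` are geodesics of initial speed `‖v‖` (`IsPolarDiffeo`). All computations are made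
with two kinds of global vector fields on `M`, so that neither Jacobi fields nor variations of
curves are needed: the push-forwards `frame Φ w` of the constant fields `w` on `V`, which commute,
and the push-forward `P = radial Φ` of the position field, with `[frame Φ w, P] = frame Φ w`.

The geodesic equation for the rays says `∇_P P = P`. With the bracket relations it gives the Gauss
lemma `⟪P, frame Φ w⟫ = ⟪v, w⟫` at `Φ v` (`IsPolarDiffeo.inner_radial_frame`), hence the symmetry
of the form `S(W, W') = ⟪∇_W P, W'⟫` (`shape`), and the Riccati equation
`P(S(W, W)) = ⟪R(P, W)P, W⟫ + |∇_W P|² - S(W, W)` for a frame field `W`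
(`IsPolarDiffeo.hasDerivAt_shape_ray`). Along the ray `t ↦ Φ (t • v)` the curvature bound makes
`(1 + K ‖v‖ t + ε) g` a strict supersolution: if `(1 + K ‖v‖ t + ε) g - S` has a null vector at time
`t`, its value at that vector is increasing there. It is positive at `t = 0`, so it stays positive
(`pos_of_deriv_pos_of_null`), and `S ≤ (1 + K ‖v‖) g` (`IsPolarDiffeo.shape_le`).

By the Gauss lemma again the smooth functions `√(ε² + ‖Φ⁻¹ x‖²)` have gradients of length at most
one, so that `d(p, Φ v) = ‖v‖` (`IsPolarDiffeo.distFrom_eq`). Therefore `ρ` is smooth away from `p`,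
its gradient is `P / ρ`, and its Hessian is `S / ρ` on the orthogonal complement of the radial
direction and vanishes on the radial direction. Its largest value on unit vectors is thus at most
`(1 + K ρ) / ρ` (`IsPolarDiffeo.hessian_distFrom_le`).
-/

set_option linter.unusedSectionVars false

noncomputable section

namespace RiemannGeom

attribute [local instance] completeSpace_model

/-! ### Push-forward of vector fields under a diffeomorphism from a vector space -/

section PushField

variable {E : Type*} [NormedAddCommGroup E] [NormedSpace ℝ E] [FiniteDimensional ℝ E]
  {M : Type*} [TopologicalSpace M] [ChartedSpace E M] [IsManifold 𝓘(ℝ, E) ∞ M]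
  {V : Type*} [NormedAddCommGroup V] [NormedSpace ℝ V] [FiniteDimensional ℝ V]
  (Φ : Diffeomorph 𝓘(ℝ, V) 𝓘(ℝ, E) V M ∞)

/-- The vector field on `M` that is the push-forward of the vector field `σ` on the vector space `V`
under the diffeomorphism `Φ : V → M`, encoded as the pull-back under `Φ⁻¹`. -/
def pushField (σ : V → V) : (x : M) → TangentSpace 𝓘(ℝ, E) x :=
  mpullback 𝓘(ℝ, E) 𝓘(ℝ, V) Φ.symm σ

/-- The vector field on the vector space `V` that is the pull-back of the vector field `X` on `M`
under the diffeomorphism `Φ : V → M`. -/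
def pullField (X : (x : M) → TangentSpace 𝓘(ℝ, E) x) : V → V :=
  mpullback 𝓘(ℝ, V) 𝓘(ℝ, E) Φ X

theorem isInvertible_mfderiv_diffeo (v : V) : (mfderiv 𝓘(ℝ, V) 𝓘(ℝ, E) Φ v).IsInvertible :=
  ⟨Φ.mfderivToContinuousLinearEquiv (by simp) v, rfl⟩

theorem isInvertible_mfderiv_diffeo_symm (x : M) :
    (mfderiv 𝓘(ℝ, E) 𝓘(ℝ, V) Φ.symm x).IsInvertible :=
  ⟨Φ.symm.mfderivToContinuousLinearEquiv (by simp) x, rfl⟩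

theorem mfderiv_diffeo_symm_apply (v w : V) :
    mfderiv 𝓘(ℝ, E) 𝓘(ℝ, V) Φ.symm (Φ v) (mfderiv 𝓘(ℝ, V) 𝓘(ℝ, E) Φ v w) = w := by
  have h := mfderiv_comp_apply (I := 𝓘(ℝ, V)) (I' := 𝓘(ℝ, E)) (I'' := 𝓘(ℝ, V)) (f := Φ) (g := Φ.symm) v
    (Φ.symm.mdifferentiable (by simp) _) (Φ.mdifferentiable (by simp) _) w
  rw [← h]
  have : (Φ.symm ∘ Φ : V → V) = id := by ext; simp
  rw [this, mfderiv_id]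
  rfl

theorem pushField_apply (σ : V → V) (v : V) :
    pushField Φ σ (Φ v) = mfderiv 𝓘(ℝ, V) 𝓘(ℝ, E) Φ v (σ v) := by
  have h1 : pushField Φ σ (Φ v) =
      (mfderiv 𝓘(ℝ, E) 𝓘(ℝ, V) Φ.symm (Φ v)).inverse (σ (Φ.symm (Φ v))) := rfl
  obtain ⟨e, he⟩ := isInvertible_mfderiv_diffeo_symm Φ (Φ v)
  have h2 := mfderiv_diffeo_symm_apply Φ v (σ v)
  rw [← he] at h2 h1
  rw [h1, ContinuousLinearMap.inverse_equiv]
  apply e.injective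
  refine (e.apply_symm_apply _).trans (Eq.trans ?_ h2.symm)
  exact congrArg σ (Φ.symm_apply_apply v)

theorem pushField_pullField (X : (x : M) → TangentSpace 𝓘(ℝ, E) x) :
    pushField Φ (pullField Φ X) = X := by
  ext x
  obtain ⟨v, hv⟩ := Φ.surjective x
  replace hv : Φ v = x := hv
  subst hv
  have h1 : pullField Φ X v = (mfderiv 𝓘(ℝ, V) 𝓘(ℝ, E) Φ v).inverse (X (Φ v)) := rfl
  rw [pushField_apply, h1]
  obtain ⟨e, he⟩ := isInvertible_mfderiv_diffeo Φ v
  rw [← he, ContinuousLinearMap.inverse_equiv]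
  exact e.apply_symm_apply _

theorem pushField_add (σ τ : V → V) : pushField Φ (σ + τ) = pushField Φ σ + pushField Φ τ :=
  mpullback_add (V := σ) (V₁ := τ)

theorem pushField_smul (f : V → ℝ) (σ : V → V) (v : V) :
    pushField Φ (fun v ↦ f v • σ v) (Φ v) = f v • pushField Φ σ (Φ v) := by
  rw [pushField_apply, pushField_apply]; exact ContinuousLinearMap.map_smul _ _ _

theorem contMDiffAt_pushField {σ : V → V} {n : ℕ∞ω} {v : V} (hσ : ContDiffAt ℝ n σ v)
    (hn : n + 1 ≤ ∞) : CMDiffAt n (T% (pushField Φ σ)) (Φ v) := by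
  refine ContMDiffAt.mpullback_vectorField_preimage (n := ∞) ?_ (Φ.symm.contMDiff _)
    (isInvertible_mfderiv_diffeo_symm Φ _) hn
  rw [Φ.symm_apply_apply]
  exact contMDiffAt_vectorSpace_iff_contDiffAt.2 hσ

theorem mdifferentiableAt_pushField {σ : V → V} {v : V} (hσ : ContDiffAt ℝ ∞ σ v) :
    MDiffAt (T% (pushField Φ σ)) (Φ v) :=
  (contMDiffAt_pushField Φ (n := 1) (hσ.of_le (by simp)) (by norm_cast)).mdifferentiableAt (by simp)

theorem contDiffAt_pullField {X : (x : M) → TangentSpace 𝓘(ℝ, E) x} {n : ℕ∞ω} {v : V}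
    (hX : CMDiffAt n (T% X) (Φ v)) (hn : n + 1 ≤ ∞) : ContDiffAt ℝ n (pullField Φ X) v :=
  contMDiffAt_vectorSpace_iff_contDiffAt.1
    (ContMDiffAt.mpullback_vectorField_preimage (n := ∞) hX (Φ.contMDiff _)
      (isInvertible_mfderiv_diffeo Φ _) hn)

theorem differentiableAt_pullField {X : (x : M) → TangentSpace 𝓘(ℝ, E) x} {v : V}
    (hX : MDiffAt (T% X) (Φ v)) : DifferentiableAt ℝ (pullField Φ X) v := by
  have := MDifferentiableAt.mpullback_vectorField (n := ∞) hX (Φ.contMDiff _)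
    (isInvertible_mfderiv_diffeo Φ _) (by norm_cast)
  have h2 := ((contMDiff_snd_tangentBundle_modelSpace V 𝓘(ℝ, V) (n := 1)).mdifferentiable
    (by simp) _).comp v this
  exact h2.differentiableAt

theorem mlieBracket_pushField {σ τ : V → V} {v : V} (hσ : ContDiffAt ℝ 1 σ v)
    (hτ : ContDiffAt ℝ 1 τ v) :
    mlieBracket 𝓘(ℝ, E) (pushField Φ σ) (pushField Φ τ) (Φ v) =
      pushField Φ (lieBracket ℝ σ τ) (Φ v) := by
  have : IsManifold 𝓘(ℝ, E) (minSmoothness ℝ 2) M := by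
    rw [minSmoothness_of_isRCLikeNormedField]; infer_instance
  have hd {ρ : V → V} (hρ : ContDiffAt ℝ 1 ρ v) : MDifferentiableAt 𝓘(ℝ, V) 𝓘(ℝ, V).tangent
      (fun w ↦ (⟨w, ρ w⟩ : TangentBundle 𝓘(ℝ, V) V)) (Φ.symm (Φ v)) := by
    rw [Φ.symm_apply_apply]
    exact (contMDiffAt_vectorSpace_iff_contDiffAt.2 hρ).mdifferentiableAt (by simp)
  have h := mpullback_mlieBracket (I := 𝓘(ℝ, E)) (I' := 𝓘(ℝ, V)) (f := Φ.symm) (V := σ) (W := τ)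
    (n := ∞) (x₀ := Φ v) (hd hσ) (hd hτ) (Φ.symm.contMDiff _)
    (by rw [minSmoothness_of_isRCLikeNormedField]; norm_cast)
  refine h.symm.trans ?_
  have hb : mlieBracket 𝓘(ℝ, V) (σ : (v : V) → TangentSpace 𝓘(ℝ, V) v) τ = lieBracket ℝ σ τ :=
    (mlieBracketWithin_eq_lieBracketWithin (s := Set.univ)).trans lieBracketWithin_univ
  exact congrArg (fun X ↦ pushField Φ X (Φ v)) hb

theorem mvfderiv_mfderiv_diffeo {h : M → ℝ} {v : V} (hh : MDiffAt h (Φ v)) (w : V) :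
    mvfderiv 𝓘(ℝ, E) h (Φ v) (mfderiv 𝓘(ℝ, V) 𝓘(ℝ, E) Φ v w) = fderiv ℝ (h ∘ Φ) v w := by
  have := mvfderiv_comp_apply (f := Φ) (g := h) v hh (Φ.mdifferentiable (by simp) _) w
  rw [← this, mvfderiv, mfderiv_eq_fderiv]
  rfl

theorem mvfderiv_pushField {h : M → ℝ} {v : V} (hh : MDiffAt h (Φ v)) (σ : V → V) :
    mvfderiv 𝓘(ℝ, E) h (Φ v) (pushField Φ σ (Φ v)) = fderiv ℝ (h ∘ Φ) v (σ v) := by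
  rw [pushField_apply, mvfderiv_mfderiv_diffeo Φ hh]

theorem contDiffAt_comp_diffeo {h : M → ℝ} {n : ℕ∞ω} {v : V} (hn : n ≤ ∞) (hh : CMDiffAt n h (Φ v)) :
    ContDiffAt ℝ n (h ∘ Φ) v :=
  (hh.comp v ((Φ.contMDiff v).of_le hn)).contDiffAt

/-- Smoothness of a function on `M` can be checked in the global chart `Φ`. -/
theorem contMDiffAt_of_comp_diffeo {h : M → ℝ} {n : ℕ∞ω} {v : V} (hn : n ≤ ∞)
    (hh : ContDiffAt ℝ n (h ∘ Φ) v) : CMDiffAt n h (Φ v) := by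
  have h1 : CMDiffAt n (h ∘ Φ) (Φ.symm (Φ v)) := by
    rw [Φ.symm_apply_apply]; exact hh.contMDiffAt
  have h2 := h1.comp (Φ v) ((Φ.symm.contMDiff (Φ v)).of_le hn)
  convert h2 using 1
  ext y; simp

end PushField

/-! ### Constant-coefficient frames and smoothness of the Levi-Civita connection -/

/-- On a finite-dimensional space, a family of continuous linear maps is as smooth as its values on
each vector. -/
theorem contDiffAt_clm_apply {D F G : Type*} [NormedAddCommGroup D] [NormedSpace ℝ D]
    [NormedAddCommGroup F] [NormedSpace ℝ F] [FiniteDimensional ℝ F]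
    [NormedAddCommGroup G] [NormedSpace ℝ G] {n : ℕ∞ω} {f : D → F →L[ℝ] G} {x : D}
    (h : ∀ y, ContDiffAt ℝ n (fun x ↦ f x y) x) : ContDiffAt ℝ n f x := by
  let d := Module.finrank ℝ F
  have hd : d = Module.finrank ℝ (Fin d → ℝ) := (Module.finrank_fin_fun ℝ).symm
  let e₁ := ContinuousLinearEquiv.ofFinrankEq hd
  let e₂ := (e₁.arrowCongr (1 : G ≃L[ℝ] G)).trans (ContinuousLinearEquiv.piRing (Fin d))
  rw [← Function.id_comp f, ← e₂.symm_comp_self]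
  exact e₂.symm.contDiff.contDiffAt.comp x (contDiffAt_pi.mpr fun i ↦ h _)

section Smooth

variable {E : Type*} [NormedAddCommGroup E] [NormedSpace ℝ E] [FiniteDimensional ℝ E]
  {M : Type*} [TopologicalSpace M] [ChartedSpace E M] [IsManifold 𝓘(ℝ, E) ∞ M]
  [RiemannianBundle (fun x : M ↦ TangentSpace 𝓘(ℝ, E) x)]
  {V : Type*} [NormedAddCommGroup V] [NormedSpace ℝ V] [FiniteDimensional ℝ V]
  (Φ : Diffeomorph 𝓘(ℝ, V) 𝓘(ℝ, E) V M ∞)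

/-- The vector field on `M` that is the push-forward of the constant vector field `w` on `V`. -/
def frame (w : V) : (x : M) → TangentSpace 𝓘(ℝ, E) x := pushField Φ (fun _ ↦ w)

theorem frame_apply (w v : V) : frame Φ w (Φ v) = mfderiv 𝓘(ℝ, V) 𝓘(ℝ, E) Φ v w :=
  pushField_apply Φ _ v

theorem pushField_eq_frame (σ : V → V) (v : V) : pushField Φ σ (Φ v) = frame Φ (σ v) (Φ v) := by
  rw [frame_apply, pushField_apply]

theorem frame_add (w w' : V) : frame Φ (w + w') = frame Φ w + frame Φ w' :=
  pushField_add Φ (fun _ ↦ w) (fun _ ↦ w')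

theorem frame_smul (c : ℝ) (w : V) : frame Φ (c • w) = c • frame Φ w := by
  ext x
  obtain ⟨v, hv⟩ := Φ.surjective x
  replace hv : Φ v = x := hv
  subst hv
  exact pushField_smul Φ (fun _ ↦ c) (fun _ ↦ w) v

theorem contMDiffAt_frame (w : V) (x : M) {n : ℕ∞ω} (hn : n + 1 ≤ ∞) :
    CMDiffAt n (T% (frame Φ w)) x := by
  obtain ⟨v, hv⟩ := Φ.surjective x
  replace hv : Φ v = x := hv
  subst hv
  exact contMDiffAt_pushField Φ contDiffAt_const hn

theorem mdifferentiableAt_frame (w : V) (x : M) : MDiffAt (T% (frame Φ w)) x :=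
  (contMDiffAt_frame Φ w x (n := 1) (by norm_cast)).mdifferentiableAt (by simp)

theorem frame_eq_zero_iff {w v : V} : frame Φ w (Φ v) = 0 ↔ w = 0 := by
  obtain ⟨e, he⟩ := isInvertible_mfderiv_diffeo Φ v
  rw [frame_apply, ← he]
  exact e.map_eq_zero_iff

theorem exists_frame_eq {v : V} (u : TangentSpace 𝓘(ℝ, E) (Φ v)) : ∃ w, frame Φ w (Φ v) = u := by
  obtain ⟨e, he⟩ := isInvertible_mfderiv_diffeo Φ v
  refine ⟨e.symm u, (frame_apply Φ (e.symm u) v).trans ?_⟩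
  rw [← he]
  exact e.apply_symm_apply u

/-- The pull-back to `V` of the Riemannian metric of `M`. -/
def gram (v : V) : V →L[ℝ] V →L[ℝ] ℝ :=
  LinearMap.toContinuousBilinearMap <| LinearMap.mk₂ ℝ
    (fun w w' : V ↦ (inner ℝ (frame Φ w (Φ v)) (frame Φ w' (Φ v)) : ℝ))
    (fun _ _ _ ↦ by simp [frame_add, inner_add_left])
    (fun _ _ _ ↦ by simp [frame_smul, inner_smul_left])
    (fun _ _ _ ↦ by simp [frame_add, inner_add_right])
    (fun _ _ _ ↦ by simp [frame_smul, inner_smul_right])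

theorem gram_apply (v w w' : V) :
    gram Φ v w w' = inner ℝ (frame Φ w (Φ v)) (frame Φ w' (Φ v)) := rfl

theorem isInvertible_gram (v : V) : (gram Φ v).IsInvertible := by
  have hinj : Function.Injective (gram Φ v : V →ₗ[ℝ] V →L[ℝ] ℝ) := by
    rw [← LinearMap.ker_eq_bot, LinearMap.ker_eq_bot']
    intro w hw
    have h : gram Φ v w w = 0 := by
      have := congrArg (fun L : V →L[ℝ] ℝ ↦ L w) hw
      simpa using this
    rw [gram_apply, inner_self_eq_zero] at h
    exact (frame_eq_zero_iff Φ).1 h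
  have hd : Module.finrank ℝ V = Module.finrank ℝ (V →L[ℝ] ℝ) := by
    rw [← (LinearMap.toContinuousLinearMap (𝕜 := ℝ) (E := V) (F' := ℝ)).finrank_eq]
    exact Subspace.dual_finrank_eq.symm
  refine ⟨(LinearEquiv.ofInjectiveOfFinrankEq _ hinj hd).toContinuousLinearEquiv, ?_⟩
  ext; rfl

variable [IsContMDiffRiemannianBundle 𝓘(ℝ, E) ∞ E (fun x : M ↦ TangentSpace 𝓘(ℝ, E) x)]

theorem cmdiffAt_inner {X Y : (x : M) → TangentSpace 𝓘(ℝ, E) x} {x : M} {n : ℕ}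
    (hX : CMDiffAt n (T% X) x) (hY : CMDiffAt n (T% Y) x) :
    CMDiffAt n (fun y ↦ (inner ℝ (X y) (Y y) : ℝ)) x :=
  ContMDiffAt.inner_bundle (E := fun x : M ↦ TangentSpace 𝓘(ℝ, E) x) hX hY

theorem contDiff_gram (n : ℕ) : ContDiff ℝ n (gram Φ) := by
  rw [contDiff_iff_contDiffAt]
  intro v
  refine contDiffAt_clm_apply fun w ↦ contDiffAt_clm_apply fun w' ↦ ?_
  have hn : ((n : ℕ∞ω) + 1) ≤ ∞ := by norm_cast; exact le_top
  exact contDiffAt_comp_diffeo Φ (by norm_cast; exact le_top)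
    (cmdiffAt_inner (contMDiffAt_frame Φ w _ hn) (contMDiffAt_frame Φ w' _ hn))

/-- A vector field is as smooth as its inner products with the frame fields: its components are
recovered by inverting the Gram form. -/
theorem contMDiffAt_of_inner_frame {S : (x : M) → TangentSpace 𝓘(ℝ, E) x} {n : ℕ} {v : V}
    (h : ∀ w, CMDiffAt n (fun y ↦ (inner ℝ (S y) (frame Φ w y) : ℝ)) (Φ v)) :
    CMDiffAt n (T% S) (Φ v) := by
  have hn : ((n : ℕ∞ω) + 1) ≤ ∞ := by norm_cast; exact le_top
  have hS : S = pushField Φ (pullField Φ S) := (pushField_pullField Φ S).symm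
  have hℓ : ContDiffAt ℝ n (fun v' ↦ gram Φ v' (pullField Φ S v')) v := by
    refine contDiffAt_clm_apply fun w ↦ ?_
    have := contDiffAt_comp_diffeo Φ (by norm_cast; exact le_top) (h w)
    convert this using 2 with v'
    conv_rhs => rw [Function.comp_apply, hS]
    rw [gram_apply, pushField_eq_frame]
  have hinv : ContDiffAt ℝ n (fun v' ↦ (gram Φ v').inverse) v :=
    ((isInvertible_gram Φ v).contDiffAt_map_inverse).comp v (contDiff_gram Φ n).contDiffAt
  rw [hS]
  refine contMDiffAt_pushField Φ ?_ hn
  convert hinv.clm_apply hℓ using 2 with v'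
  obtain ⟨e, he⟩ := isInvertible_gram Φ v'
  rw [← he, ContinuousLinearMap.inverse_equiv]
  exact (e.symm_apply_apply _).symm

theorem eventually_diffeo {P : M → Prop} {v : V} (h : ∀ᶠ y in nhds (Φ v), P y) :
    ∀ᶠ v' in nhds v, P (Φ v') := (Φ.contMDiff.continuous.tendsto v).eventually h

theorem eventually_mdifferentiableAt {Z : (x : M) → TangentSpace 𝓘(ℝ, E) x} {x : M}
    (hZ : CMDiffAt 1 (T% Z) x) : ∀ᶠ y in nhds x, MDiffAt (T% Z) y :=
  ((contMDiffAt_iff_contMDiffAt_nhds (by simp)).1 hZ).mono fun _ h ↦ h.mdifferentiableAt (by simp)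

theorem contMDiffAt_mvfderiv {h : M → ℝ} {X : (x : M) → TangentSpace 𝓘(ℝ, E) x} {n : ℕ} {v : V}
    (hh : CMDiffAt (n + 1 : ℕ) h (Φ v)) (hX : CMDiffAt n (T% X) (Φ v)) :
    CMDiffAt n (fun y ↦ mvfderiv 𝓘(ℝ, E) h y (X y)) (Φ v) := by
  have hn : ((n : ℕ∞ω) + 1) ≤ ∞ := by norm_cast; exact le_top
  refine contMDiffAt_of_comp_diffeo Φ (by norm_cast; exact le_top) ?_
  have h1 : ContDiffAt ℝ n (fun v' ↦ fderiv ℝ (h ∘ Φ) v' (pullField Φ X v')) v :=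
    ((contDiffAt_comp_diffeo Φ (by norm_cast; exact le_top) hh).fderiv_right
      (by norm_cast)).clm_apply (contDiffAt_pullField Φ hX hn)
  refine h1.congr_of_eventuallyEq ?_
  have h2 : ∀ᶠ y in nhds (Φ v), MDiffAt h y :=
    ((contMDiffAt_iff_contMDiffAt_nhds (by simp)).1 (hh.of_le (m := 1) (by norm_cast; omega))).mono
      fun _ h ↦ h.mdifferentiableAt (by simp)
  filter_upwards [eventually_diffeo Φ h2] with v' hv'
  rw [← mvfderiv_pushField Φ hv' (pullField Φ X), pushField_pullField, Function.comp_apply]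

/-- The covariant derivative of a `C^(n+1)` field along a frame field is `C^n`, since by the Koszul
formula its inner products with the frame fields are. -/
theorem contMDiffAt_leviCivita_frame {Z : (x : M) → TangentSpace 𝓘(ℝ, E) x} {n : ℕ} {v : V}
    (hZ : CMDiffAt (n + 1 : ℕ) (T% Z) (Φ v)) (w : V) :
    CMDiffAt n (T% (fun y ↦ leviCivita E M Z y (frame Φ w y))) (Φ v) := by
  have hle {m : ℕ} : ((m : ℕ∞ω) + 1) ≤ ∞ := by norm_cast; exact le_top
  have hf {m : ℕ} (w' : V) : CMDiffAt m (T% (frame Φ w')) (Φ v) := contMDiffAt_frame Φ w' _ hle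
  refine contMDiffAt_of_inner_frame Φ fun w' ↦ ?_
  have hev : (fun y ↦ (inner ℝ (leviCivita E M Z y (frame Φ w y)) (frame Φ w' y) : ℝ))
      =ᶠ[nhds (Φ v)] koszul (frame Φ w) Z (frame Φ w') := by
    filter_upwards [eventually_mdifferentiableAt (hZ.of_le (m := 1) (by norm_cast; omega))] with y hy
    exact inner_leviCivita (mdifferentiableAt_frame Φ w y) hy (mdifferentiableAt_frame Φ w' y)
  refine ContMDiffAt.congr_of_eventuallyEq ?_ hev
  have hZ' : CMDiffAt n (T% Z) (Φ v) := hZ.of_le (by norm_cast; omega)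
  have hb {X Y : (x : M) → TangentSpace 𝓘(ℝ, E) x} (hX : CMDiffAt (n + 1 : ℕ) (T% X) (Φ v))
      (hY : CMDiffAt (n + 1 : ℕ) (T% Y) (Φ v)) : CMDiffAt n (T% (mlieBracket 𝓘(ℝ, E) X Y)) (Φ v) := by
    have : IsManifold 𝓘(ℝ, E) ((((n + 1 : ℕ) : ℕ∞) : ℕ∞ω) + 1) M := IsManifold.of_le (n := ∞) hle
    have : IsManifold 𝓘(ℝ, E) (minSmoothness ℝ 2) M := by
      rw [minSmoothness_of_isRCLikeNormedField]; infer_instance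
    have : IsManifold 𝓘(ℝ, E) (minSmoothness ℝ 3) M := by
      rw [minSmoothness_of_isRCLikeNormedField]; exact IsManifold.of_le (n := ∞) (by norm_cast)
    refine ContMDiffAt.mlieBracket_vectorField (m := (n : ℕ∞)) (n := ((n + 1 : ℕ) : ℕ∞)) hX hY ?_
    rw [minSmoothness_of_isRCLikeNormedField]
    norm_cast
  unfold koszul
  simp only [div_eq_mul_inv]
  refine ContMDiffAt.mul (ContMDiffAt.add (ContMDiffAt.sub (ContMDiffAt.add (ContMDiffAt.sub
    (ContMDiffAt.add ?_ ?_) ?_) ?_) ?_) ?_) contMDiffAt_const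
  · exact contMDiffAt_mvfderiv Φ (cmdiffAt_inner hZ (hf w')) (hf w)
  · exact contMDiffAt_mvfderiv Φ (cmdiffAt_inner (hf w') (hf w)) hZ'
  · exact contMDiffAt_mvfderiv Φ (cmdiffAt_inner (hf w) hZ) (hf w')
  · exact cmdiffAt_inner (hb (hf w) hZ) (hf w')
  · exact cmdiffAt_inner (hb hZ (hf w')) (hf w)
  · exact cmdiffAt_inner (hb (hf w') (hf w)) hZ'

/-- If `Z` is `C²` and `X` differentiable then `∇_X Z` is differentiable: expand `X` in the frame
fields of a basis of `V`. -/
theorem mdifferentiableAt_leviCivita {X Z : (x : M) → TangentSpace 𝓘(ℝ, E) x} {v : V}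
    (hZ : CMDiffAt 2 (T% Z) (Φ v)) (hX : MDiffAt (T% X) (Φ v)) :
    MDiffAt (T% (fun y ↦ leviCivita E M Z y (X y))) (Φ v) := by
  let b := Module.finBasis ℝ V
  have hc (i) : MDiffAt (fun y ↦ b.coord i (pullField Φ X (Φ.symm y))) (Φ v) := by
    have h1 : DifferentiableAt ℝ (fun v' ↦ b.coord i (pullField Φ X v')) v :=
      (LinearMap.toContinuousLinearMap (b.coord i)).differentiableAt.comp v
        (differentiableAt_pullField Φ hX)
    have h2 : MDifferentiableAt 𝓘(ℝ, V) 𝓘(ℝ) (fun v' ↦ b.coord i (pullField Φ X v'))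
      (Φ.symm (Φ v)) := by rw [Φ.symm_apply_apply]; exact h1.mdifferentiableAt
    exact h2.comp (Φ v) (Φ.symm.mdifferentiable (by simp) _)
  have heq (y : M) : leviCivita E M Z y (X y) = ∑ i,
      ((fun y ↦ b.coord i (pullField Φ X (Φ.symm y))) •
        (fun y ↦ leviCivita E M Z y (frame Φ (b i) y))) y := by
    obtain ⟨v', hv'⟩ := Φ.surjective y
    replace hv' : Φ v' = y := hv'
    subst hv'
    have hX' : X (Φ v') = ∑ i, b.coord i (pullField Φ X v') • frame Φ (b i) (Φ v') := by
      conv_lhs => rw [← pushField_pullField Φ X, pushField_apply, ← b.sum_repr (pullField Φ X v')]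
      simp only [frame_apply, Module.Basis.coord_apply]
      erw [map_sum]
      refine Finset.sum_congr rfl fun i _ ↦ ?_
      exact ContinuousLinearMap.map_smul _ _ _
    rw [hX', map_sum]
    simp
  simp_rw [heq]
  refine MDifferentiableAt.sum_section fun i _ ↦ (hc i).smul_section ?_
  exact (contMDiffAt_leviCivita_frame Φ (n := 1) hZ (b i)).mdifferentiableAt (by simp)

end Smooth

/-! ### Identities for the connection and its curvature -/

theorem mvfderiv_congr {E : Type*} [NormedAddCommGroup E] [NormedSpace ℝ E]
    {M : Type*} [TopologicalSpace M] [ChartedSpace E M]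
    {F : Type*} [NormedAddCommGroup F] [NormedSpace ℝ F] {h h' : M → F} {x : M}
    (hh : h =ᶠ[nhds x] h') : mvfderiv 𝓘(ℝ, E) h x = mvfderiv 𝓘(ℝ, E) h' x :=
  ContinuousLinearMap.ext fun u ↦ DFunLike.congr_fun (hh.mfderiv_eq (I := 𝓘(ℝ, E)) (I' := 𝓘(ℝ, F))) u

section Curvature

variable {E : Type*} [NormedAddCommGroup E] [NormedSpace ℝ E] [FiniteDimensional ℝ E]
  {M : Type*} [TopologicalSpace M] [ChartedSpace E M] [IsManifold 𝓘(ℝ, E) ∞ M]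
  [RiemannianBundle (fun x : M ↦ TangentSpace 𝓘(ℝ, E) x)]
  [IsContMDiffRiemannianBundle 𝓘(ℝ, E) ∞ E (fun x : M ↦ TangentSpace 𝓘(ℝ, E) x)]
  {V : Type*} [NormedAddCommGroup V] [NormedSpace ℝ V] [FiniteDimensional ℝ V]
  (Φ : Diffeomorph 𝓘(ℝ, V) 𝓘(ℝ, E) V M ∞)

/-- Metric compatibility, for the derivative along a single tangent vector. -/
theorem mvfderiv_inner {Y Z : (x : M) → TangentSpace 𝓘(ℝ, E) x} {x : M}
    (hY : MDiffAt (T% Y) x) (hZ : MDiffAt (T% Z) x) (u : TangentSpace 𝓘(ℝ, E) x) :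
    mvfderiv 𝓘(ℝ, E) (fun y ↦ inner ℝ (Y y) (Z y)) x u =
      inner ℝ (leviCivita E M Y x u) (Z x) + inner ℝ (Y x) (leviCivita E M Z x u) := by
  have := leviCivita_metric (X := extend E u) (mdifferentiableAt_extend ..) hY hZ
  simpa using this

/-- Vanishing of the torsion. -/
theorem leviCivita_sub_leviCivita {X Y : (x : M) → TangentSpace 𝓘(ℝ, E) x} {x : M}
    (hX : MDiffAt (T% X) x) (hY : MDiffAt (T% Y) x) :
    leviCivita E M Y x (X x) - leviCivita E M X x (Y x) = mlieBracket 𝓘(ℝ, E) X Y x :=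
  ((leviCivita E M).torsion_eq_zero_iff).1 leviCivita_torsion hX hY

theorem curvatureField_swap (X Y Z : (x : M) → TangentSpace 𝓘(ℝ, E) x) (x : M) :
    curvatureField X Y Z x = - curvatureField Y X Z x := by
  rw [curvatureField, curvatureField, mlieBracket_swap_apply, map_neg]
  abel

theorem tensorialAt_curvatureField_left {Y Z : (x : M) → TangentSpace 𝓘(ℝ, E) x} {v : V}
    (hZ : CMDiffAt 2 (T% Z) (Φ v)) :
    TensorialAt 𝓘(ℝ, E) E (curvatureField · Y Z (Φ v)) (Φ v) where
  smul {f X} hf hX := by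
    have h2 := (leviCivita E M).isCovariantDerivativeOnUniv.leibniz
      (mdifferentiableAt_leviCivita Φ hZ hX) hf
    have h3 : (fun y ↦ leviCivita E M Z y ((f • X) y)) =
        f • (fun y ↦ leviCivita E M Z y (X y)) := by ext y; simp
    simp only [curvatureField, h3, mlieBracket_smul_left hf hX]
    rw [h2]
    simp
    module
  add {X X'} hX hX' := by
    have h2 := (leviCivita E M).isCovariantDerivativeOnUniv.add
      (mdifferentiableAt_leviCivita Φ hZ hX) (mdifferentiableAt_leviCivita Φ hZ hX')
    have h3 : (fun y ↦ leviCivita E M Z y ((X + X') y)) =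
        (fun y ↦ leviCivita E M Z y (X y)) + (fun y ↦ leviCivita E M Z y (X' y)) := by
      ext y; simp
    simp only [curvatureField, h3, mlieBracket_add_left hX hX']
    rw [h2]
    simp
    abel

/-- The value of `R(X,Y)Z` at a point depends on `X` and `Y` only through their values there. -/
theorem curvatureField_congr {X X' Y Y' Z : (x : M) → TangentSpace 𝓘(ℝ, E) x} {v : V}
    (hX : MDiffAt (T% X) (Φ v)) (hX' : MDiffAt (T% X') (Φ v)) (hY : MDiffAt (T% Y) (Φ v))
    (hY' : MDiffAt (T% Y') (Φ v)) (hZ : CMDiffAt 2 (T% Z) (Φ v)) (hXX' : X (Φ v) = X' (Φ v))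
    (hYY' : Y (Φ v) = Y' (Φ v)) : curvatureField X Y Z (Φ v) = curvatureField X' Y' Z (Φ v) := by
  rw [(tensorialAt_curvatureField_left Φ hZ).pointwise hX hX' hXX', curvatureField_swap,
    (tensorialAt_curvatureField_left Φ hZ).pointwise hY hY' hYY', ← curvatureField_swap]

/-- The Lie bracket is the commutator of derivations: `[X,Y]h = X(Yh) - Y(Xh)`. -/
theorem mvfderiv_mlieBracket {X Y : (x : M) → TangentSpace 𝓘(ℝ, E) x} {h : M → ℝ} {v : V}
    (hX : CMDiffAt 1 (T% X) (Φ v)) (hY : CMDiffAt 1 (T% Y) (Φ v)) (hh : CMDiffAt 2 h (Φ v)) :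
    mvfderiv 𝓘(ℝ, E) h (Φ v) (mlieBracket 𝓘(ℝ, E) X Y (Φ v)) =
      mvfderiv 𝓘(ℝ, E) (fun y ↦ mvfderiv 𝓘(ℝ, E) h y (Y y)) (Φ v) (X (Φ v)) -
      mvfderiv 𝓘(ℝ, E) (fun y ↦ mvfderiv 𝓘(ℝ, E) h y (X y)) (Φ v) (Y (Φ v)) := by
  have h2 : ∀ᶠ y in nhds (Φ v), MDiffAt h y :=
    ((contMDiffAt_iff_contMDiffAt_nhds (by simp)).1 (hh.of_le (m := 1) (by norm_cast))).mono
      fun _ h ↦ h.mdifferentiableAt (by simp)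
  have hk : ContDiffAt ℝ 2 (h ∘ Φ) v := contDiffAt_comp_diffeo Φ (by norm_cast) hh
  have key {X Y : (x : M) → TangentSpace 𝓘(ℝ, E) x} (hY : CMDiffAt 1 (T% Y) (Φ v)) :
      mvfderiv 𝓘(ℝ, E) (fun y ↦ mvfderiv 𝓘(ℝ, E) h y (Y y)) (Φ v) (X (Φ v)) =
        fderiv ℝ (h ∘ Φ) v (fderiv ℝ (pullField Φ Y) v (pullField Φ X v)) +
        fderiv ℝ (fderiv ℝ (h ∘ Φ)) v (pullField Φ X v) (pullField Φ Y v) := by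
    have hd := (contMDiffAt_mvfderiv Φ (n := 1) hh hY).mdifferentiableAt (by simp)
    have hev : (fun y ↦ mvfderiv 𝓘(ℝ, E) h y (Y y)) ∘ Φ =ᶠ[nhds v]
        fun v' ↦ fderiv ℝ (h ∘ Φ) v' (pullField Φ Y v') := by
      filter_upwards [eventually_diffeo Φ h2] with v' hv'
      rw [← mvfderiv_pushField Φ hv' (pullField Φ Y), pushField_pullField, Function.comp_apply]
    conv_lhs => rw [← pushField_pullField Φ X]
    rw [mvfderiv_pushField Φ hd, hev.fderiv_eq, fderiv_clm_apply
      ((hk.fderiv_right (m := 1) (by norm_cast)).differentiableAt (by simp))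
      (differentiableAt_pullField Φ (hY.mdifferentiableAt (by simp)))]
    simp
  rw [key hX, key hY, (hk.isSymmSndFDerivAt (by simp)).eq (pullField Φ X v) (pullField Φ Y v)]
  have hb := mlieBracket_pushField Φ (contDiffAt_pullField Φ hX (by norm_cast))
    (contDiffAt_pullField Φ hY (by norm_cast))
  rw [pushField_pullField, pushField_pullField] at hb
  rw [hb, mvfderiv_pushField Φ (hh.mdifferentiableAt (by simp)), lieBracket_eq, map_sub]
  ring

/-- Metric compatibility makes `R(X,Y)` skew-symmetric. -/
theorem inner_curvatureField_skew {X Y Z T : (x : M) → TangentSpace 𝓘(ℝ, E) x} {v : V}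
    (hX : CMDiffAt 1 (T% X) (Φ v)) (hY : CMDiffAt 1 (T% Y) (Φ v))
    (hZ : CMDiffAt 2 (T% Z) (Φ v)) (hT : CMDiffAt 2 (T% T) (Φ v)) :
    (inner ℝ (curvatureField X Y Z (Φ v)) (T (Φ v)) : ℝ) =
      - inner ℝ (curvatureField X Y T (Φ v)) (Z (Φ v)) := by
  have hZ1 := eventually_mdifferentiableAt (hZ.of_le (m := 1) (by norm_cast))
  have hT1 := eventually_mdifferentiableAt (hT.of_le (m := 1) (by norm_cast))
  -- `XY⟪Z,T⟫` expanded by metric compatibility; the mixed terms are symmetric in `X` and `Y`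
  have key {X Y : (x : M) → TangentSpace 𝓘(ℝ, E) x} (hY : CMDiffAt 1 (T% Y) (Φ v)) :
      mvfderiv 𝓘(ℝ, E) (fun y ↦ mvfderiv 𝓘(ℝ, E) (fun z ↦ (inner ℝ (Z z) (T z) : ℝ)) y (Y y))
          (Φ v) (X (Φ v)) =
        inner ℝ (leviCivita E M (fun y ↦ leviCivita E M Z y (Y y)) (Φ v) (X (Φ v))) (T (Φ v))
        + inner ℝ (leviCivita E M Z (Φ v) (Y (Φ v))) (leviCivita E M T (Φ v) (X (Φ v)))
        + (inner ℝ (leviCivita E M Z (Φ v) (X (Φ v))) (leviCivita E M T (Φ v) (Y (Φ v)))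
        + inner ℝ (Z (Φ v)) (leviCivita E M (fun y ↦ leviCivita E M T y (Y y)) (Φ v) (X (Φ v)))) := by
    have hY' := hY.mdifferentiableAt (by simp)
    have hev : (fun y ↦ mvfderiv 𝓘(ℝ, E) (fun z ↦ (inner ℝ (Z z) (T z) : ℝ)) y (Y y))
        =ᶠ[nhds (Φ v)] fun y ↦ (inner ℝ (leviCivita E M Z y (Y y)) (T y) : ℝ) +
          inner ℝ (Z y) (leviCivita E M T y (Y y)) := by
      filter_upwards [hZ1, hT1] with y h1 h2
      exact mvfderiv_inner h1 h2 _
    have hdZ := mdifferentiableAt_leviCivita Φ hZ hY'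
    have hdT := mdifferentiableAt_leviCivita Φ hT hY'
    have e1 : mvfderiv 𝓘(ℝ, E)
        (fun y ↦ mvfderiv 𝓘(ℝ, E) (fun z ↦ (inner ℝ (Z z) (T z) : ℝ)) y (Y y)) (Φ v) =
        mvfderiv 𝓘(ℝ, E) (fun y ↦ (inner ℝ (leviCivita E M Z y (Y y)) (T y) : ℝ) +
          inner ℝ (Z y) (leviCivita E M T y (Y y))) (Φ v) := mvfderiv_congr hev
    rw [e1, mvfderiv_fun_add (mdiff_inner hdZ hT1.self_of_nhds) (mdiff_inner hZ1.self_of_nhds hdT),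
      add_apply, mvfderiv_inner hdZ hT1.self_of_nhds, mvfderiv_inner hZ1.self_of_nhds hdT]
  have hc := mvfderiv_mlieBracket Φ hX hY
    (ContMDiffAt.inner_bundle (E := fun x : M ↦ TangentSpace 𝓘(ℝ, E) x) hZ hT)
  rw [key hX, key hY, mvfderiv_inner hZ1.self_of_nhds hT1.self_of_nhds] at hc
  simp only [curvatureField, inner_sub_left]
  rw [real_inner_comm (Z (Φ v)), real_inner_comm (Z (Φ v)), real_inner_comm (Z (Φ v))]
  linarith

end Curvature

section Along

variable {E : Type*} [NormedAddCommGroup E] [NormedSpace ℝ E] [FiniteDimensional ℝ E]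
  {M : Type*} [TopologicalSpace M] [ChartedSpace E M] [IsManifold 𝓘(ℝ, E) ∞ M]
  [RiemannianBundle (fun x : M ↦ TangentSpace 𝓘(ℝ, E) x)]
  [IsContMDiffRiemannianBundle 𝓘(ℝ, E) ∞ E (fun x : M ↦ TangentSpace 𝓘(ℝ, E) x)]

/-- The coordinates of a vector field in the preferred trivialization at `x`. -/
def localCoord (x : M) (Y : (x : M) → TangentSpace 𝓘(ℝ, E) x) (y : M) : E :=
  (trivializationAt E (fun x : M ↦ TangentSpace 𝓘(ℝ, E) x) x ⟨y, Y y⟩).2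

theorem mdifferentiableAt_localCoord {Y : (x : M) → TangentSpace 𝓘(ℝ, E) x} {x : M}
    (hY : MDiffAt (T% Y) x) : MDifferentiableAt 𝓘(ℝ, E) 𝓘(ℝ, E) (localCoord x Y) x :=
  (mdifferentiableAt_section 𝓘(ℝ, E) (E := fun x : M ↦ TangentSpace 𝓘(ℝ, E) x) Y).1 hY

theorem localCoord_smul (x : M) (f : M → ℝ) (Y : (x : M) → TangentSpace 𝓘(ℝ, E) x) :
    localCoord x (f • Y) =ᶠ[nhds x] fun y ↦ f y • localCoord x Y y := by
  set e := trivializationAt E (fun x : M ↦ TangentSpace 𝓘(ℝ, E) x) x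
  filter_upwards [e.open_baseSet.mem_nhds (FiberBundle.mem_baseSet_trivializationAt' x)] with y hy
  exact (e.linear ℝ hy).map_smul (f y) (Y y)

theorem localCoord_add (x : M) (Y Z : (x : M) → TangentSpace 𝓘(ℝ, E) x) :
    localCoord x (Y + Z) =ᶠ[nhds x] fun y ↦ localCoord x Y y + localCoord x Z y := by
  set e := trivializationAt E (fun x : M ↦ TangentSpace 𝓘(ℝ, E) x) x
  filter_upwards [e.open_baseSet.mem_nhds (FiberBundle.mem_baseSet_trivializationAt' x)] with y hy
  exact (e.linear ℝ hy).map_add (Y y) (Z y)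

theorem localCoord_extend (x : M) (u : TangentSpace 𝓘(ℝ, E) x) :
    localCoord x (extend E u) =ᶠ[nhds x]
      fun _ ↦ (trivializationAt E (fun x : M ↦ TangentSpace 𝓘(ℝ, E) x) x ⟨x, u⟩).2 := by
  set e := trivializationAt E (fun x : M ↦ TangentSpace 𝓘(ℝ, E) x) x
  filter_upwards [e.open_baseSet.mem_nhds (FiberBundle.mem_baseSet_trivializationAt' x)] with y hy
  have h := congrArg Prod.snd (e.apply_mk_symm hy (e ⟨x, u⟩).2)
  exact h

/-- In the preferred trivialization the Levi-Civita connection is the derivative of the coordinates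
plus a term depending on the value at the point only. -/
theorem leviCivita_eq_localCoord {Y : (x : M) → TangentSpace 𝓘(ℝ, E) x} {x : M}
    (hY : MDiffAt (T% Y) x) (u : TangentSpace 𝓘(ℝ, E) x) :
    leviCivita E M Y x u =
      (trivializationAt E (fun x : M ↦ TangentSpace 𝓘(ℝ, E) x) x).symm x
        (mvfderiv 𝓘(ℝ, E) (localCoord x Y) x u) + leviCivita E M (extend E (Y x)) x u := by
  set e := trivializationAt E (fun x : M ↦ TangentSpace 𝓘(ℝ, E) x) x with he
  have hx : x ∈ e.baseSet := FiberBundle.mem_baseSet_trivializationAt' x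
  have hsymm (a : E) : e.symm x a = e.symmL ℝ x a := (e.symmL_apply hx a).symm
  -- the difference of two connections is tensorial, so `Y` may be replaced by `extend E (Y x)`,
  -- whose coordinates are constant
  have hT : TensorialAt 𝓘(ℝ, E) E (fun Y ↦ leviCivita E M Y x u -
      e.symmL ℝ x (mvfderiv 𝓘(ℝ, E) (localCoord x Y) x u)) x :=
    { smul := by
        intro f Y hf hY
        have h1 := (leviCivita E M).isCovariantDerivativeOnUniv.leibniz hY hf
        have h2 := mvfderiv_fun_smul hf (mdifferentiableAt_localCoord hY)
        have h3 : e.symmL ℝ x (localCoord x Y x) = Y x :=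
          (hsymm _).symm.trans (e.symm_apply_apply_mk hx (Y x))
        rw [mvfderiv_congr (localCoord_smul x f Y), h2]
        change (leviCivita E M).toFun _ _ _ - _ = _
        rw [h1]
        simp [h3]
        module
      add := by
        intro Y Z hY hZ
        have h1 := (leviCivita E M).isCovariantDerivativeOnUniv.add hY hZ
        have h2 := mvfderiv_fun_add (mdifferentiableAt_localCoord hY)
          (mdifferentiableAt_localCoord hZ)
        rw [mvfderiv_congr (localCoord_add x Y Z), h2]
        change (leviCivita E M).toFun _ _ _ - _ = _
        rw [h1]
        simp
        abel }
  have := hT.pointwise hY (mdifferentiableAt_extend 𝓘(ℝ, E) E (Y x)) (by simp)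
  rw [mvfderiv_congr (localCoord_extend x (Y x)), mvfderiv_const] at this
  rw [hsymm, ← sub_eq_iff_eq_add', this]
  simp

/-- The covariant derivative along `γ` of the restriction of `c • Y`, for a vector field `Y`. -/
theorem covDerivAlong_of_eventuallyEq_smul {γ : ℝ → M} {c : ℝ → ℝ} {t : ℝ}
    {Y : (x : M) → TangentSpace 𝓘(ℝ, E) x} {U : (t : ℝ) → TangentSpace 𝓘(ℝ, E) (γ t)}
    (hγ : MDifferentiableAt 𝓘(ℝ, ℝ) 𝓘(ℝ, E) γ t) (hc : DifferentiableAt ℝ c t)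
    (hY : MDiffAt (T% Y) (γ t)) (hU : ∀ᶠ s in nhds t, U s = c s • Y (γ s)) :
    covDerivAlong γ U t =
      deriv c t • Y (γ t) + c t • leviCivita E M Y (γ t) (velocity γ t) := by
  set e := trivializationAt E (fun x : M ↦ TangentSpace 𝓘(ℝ, E) x) (γ t) with he
  have hx : γ t ∈ e.baseSet := FiberBundle.mem_baseSet_trivializationAt' (γ t)
  have hsymm (a : E) : e.symm (γ t) a = e.symmL ℝ (γ t) a :=
    (e.symmL_apply hx a).symm
  have hcoord := mdifferentiableAt_localCoord hY
  have h1 : (fun s ↦ (e ⟨γ s, U s⟩).2) =ᶠ[nhds t] fun s ↦ c s • localCoord (γ t) Y (γ s) := by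
    have hb := hγ.continuousAt.preimage_mem_nhds (e.open_baseSet.mem_nhds hx)
    filter_upwards [hb, hU] with s hs hs'
    rw [hs']
    exact (e.linear ℝ hs).map_smul (c s) (Y (γ s))
  have h2 : HasDerivAt (fun s ↦ localCoord (γ t) Y (γ s))
      (mvfderiv 𝓘(ℝ, E) (localCoord (γ t) Y) (γ t) (velocity γ t)) t := by
    let L : ℝ →L[ℝ] E := (mfderiv 𝓘(ℝ, E) 𝓘(ℝ, E) (localCoord (γ t) Y) (γ t)).comp
      (mfderiv 𝓘(ℝ, ℝ) 𝓘(ℝ, E) γ t)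
    have h : HasFDerivAt (fun s ↦ localCoord (γ t) Y (γ s)) L t :=
      (hcoord.hasMFDerivAt.comp t hγ.hasMFDerivAt).hasFDerivAt
    exact h.hasDerivAt
  have h3 : deriv (fun s ↦ (e ⟨γ s, U s⟩).2) t = c t •
      mvfderiv 𝓘(ℝ, E) (localCoord (γ t) Y) (γ t) (velocity γ t) +
        deriv c t • localCoord (γ t) Y (γ t) := by
    rw [h1.deriv_eq]
    exact (hc.hasDerivAt.smul h2).deriv
  have h4 : e.symmL ℝ (γ t) (localCoord (γ t) Y (γ t)) = Y (γ t) :=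
    (hsymm _).symm.trans (e.symm_apply_apply_mk hx _)
  have hcY : MDiffAt (T% (c t • Y)) (γ t) := hY.smul_const_section
  have h5 := leviCivita_eq_localCoord hcY (velocity γ t)
  have h6 := leviCivita_eq_localCoord hY (velocity γ t)
  rw [← he, hsymm] at h6
  have h7 : leviCivita E M (c t • Y) (γ t) = c t • leviCivita E M Y (γ t) :=
    (leviCivita E M).isCovariantDerivativeOnUniv.smul_const (c t) hY
  have h8 : localCoord (γ t) (c t • Y) =ᶠ[nhds (γ t)] fun y ↦ c t • localCoord (γ t) Y y :=
    localCoord_smul (γ t) (fun _ ↦ c t) Y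
  have h9 : mvfderiv 𝓘(ℝ, E) (fun y ↦ c t • localCoord (γ t) Y y) (γ t) =
      c t • mvfderiv 𝓘(ℝ, E) (localCoord (γ t) Y) (γ t) := by
    have := mvfderiv_fun_smul (mdifferentiableAt_const (c := c t) (x := γ t) (I := 𝓘(ℝ, E))) hcoord
    rw [mvfderiv_const] at this
    rw [this]
    ext; simp
  have h10 : mvfderiv 𝓘(ℝ, E) (localCoord (γ t) (c t • Y)) (γ t) (velocity γ t) =
      c t • mvfderiv 𝓘(ℝ, E) (localCoord (γ t) Y) (γ t) (velocity γ t) := by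
    rw [mvfderiv_congr h8, h9, smul_apply]
  rw [h10, ← he, hsymm, h7] at h5
  change e.symm (γ t) (deriv (fun s ↦ (e ⟨γ s, U s⟩).2) t) +
    leviCivita E M (extend E (U t)) (γ t) (velocity γ t) = _
  rw [h3, hU.self_of_nhds, hsymm]
  simp only [map_add, map_smul, h4] at h5 ⊢
  have h11 : (c t • Y) (γ t) = c t • Y (γ t) := rfl
  rw [h11] at h5
  rw [smul_apply] at h5
  rw [h5]
  abel

end Along

/-! ### Polar coordinates and the Gauss lemma -/

section Polar

variable {E : Type*} [NormedAddCommGroup E] [NormedSpace ℝ E] [FiniteDimensional ℝ E]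
  {M : Type*} [TopologicalSpace M] [ChartedSpace E M] [IsManifold 𝓘(ℝ, E) ∞ M]
  [RiemannianBundle (fun x : M ↦ TangentSpace 𝓘(ℝ, E) x)]
  [IsContMDiffRiemannianBundle 𝓘(ℝ, E) ∞ E (fun x : M ↦ TangentSpace 𝓘(ℝ, E) x)]
  {V : Type*} [NormedAddCommGroup V] [InnerProductSpace ℝ V] [FiniteDimensional ℝ V]
  {Φ : Diffeomorph 𝓘(ℝ, V) 𝓘(ℝ, E) V M ∞}

/-- A diffeomorphism from an inner product space that maps the rays `t ↦ t • v` to geodesics whose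
initial speed is `‖v‖`: the exponential map at a pole, up to a linear isometry of the domain. -/
structure IsPolarDiffeo (Φ : Diffeomorph 𝓘(ℝ, V) 𝓘(ℝ, E) V M ∞) : Prop where
  isGeodesic : ∀ v : V, IsGeodesic E (fun t : ℝ ↦ Φ (t • v))
  norm_velocity : ∀ v : V, ‖velocity (E := E) (fun t : ℝ ↦ Φ (t • v)) 0‖ = ‖v‖

theorem velocity_ray (Φ : Diffeomorph 𝓘(ℝ, V) 𝓘(ℝ, E) V M ∞) (v : V) (t : ℝ) :
    velocity (E := E) (fun t : ℝ ↦ Φ (t • v)) t = frame Φ v (Φ (t • v)) := by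
  have h1 : HasFDerivAt (fun t : ℝ ↦ t • v) ((1 : ℝ →L[ℝ] ℝ).smulRight v) t :=
    (hasDerivAt_id t).smul_const v |>.hasFDerivAt.congr_fderiv (by ext; simp)
  have h2 := ((Φ.mdifferentiable (by simp) (t • v)).hasMFDerivAt.comp t h1.hasMFDerivAt).mfderiv
  rw [frame_apply, velocity]
  have h3 := DFunLike.congr_fun h2 (1 : ℝ)
  refine h3.trans ?_
  exact congrArg (mfderiv 𝓘(ℝ, V) 𝓘(ℝ, E) Φ (t • v)) (one_smul ℝ v)

/-- The push-forward of the Euler (position) vector field of `V`. -/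
def radial (Φ : Diffeomorph 𝓘(ℝ, V) 𝓘(ℝ, E) V M ∞) : (x : M) → TangentSpace 𝓘(ℝ, E) x :=
  pushField Φ id

theorem radial_apply (v : V) : radial Φ (Φ v) = frame Φ v (Φ v) := pushField_eq_frame Φ id v

theorem radial_smul (v : V) (t : ℝ) : radial Φ (Φ (t • v)) = t • frame Φ v (Φ (t • v)) := by
  rw [radial_apply, frame_smul]; rfl

theorem contMDiffAt_radial (v : V) {n : ℕ∞ω} (hn : n + 1 ≤ ∞) :
    CMDiffAt n (T% (radial Φ)) (Φ v) := contMDiffAt_pushField Φ contDiffAt_id hn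

theorem mdifferentiableAt_radial (v : V) : MDiffAt (T% (radial Φ)) (Φ v) :=
  mdifferentiableAt_pushField Φ contDiffAt_id

theorem mlieBracket_frame_radial (w v : V) :
    mlieBracket 𝓘(ℝ, E) (frame Φ w) (radial Φ) (Φ v) = frame Φ w (Φ v) := by
  rw [frame, radial, mlieBracket_pushField Φ contDiffAt_const contDiffAt_id, pushField_eq_frame]
  simp [lieBracket_eq, frame]

theorem mlieBracket_frame_frame (w w' v : V) :
    mlieBracket 𝓘(ℝ, E) (frame Φ w) (frame Φ w') (Φ v) = 0 := by
  rw [frame, frame, mlieBracket_pushField Φ contDiffAt_const contDiffAt_const, pushField_eq_frame]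
  simp [lieBracket_eq, frame_eq_zero_iff]

theorem leviCivita_frame_radial (w v : V) :
    leviCivita E M (frame Φ w) (Φ v) (radial Φ (Φ v)) =
      leviCivita E M (radial Φ) (Φ v) (frame Φ w (Φ v)) - frame Φ w (Φ v) := by
  have := leviCivita_sub_leviCivita (mdifferentiableAt_frame Φ w (Φ v)) (mdifferentiableAt_radial v)
  rw [mlieBracket_frame_radial] at this
  exact (sub_eq_of_eq_add' (sub_eq_iff_eq_add.1 this)).symm

theorem leviCivita_frame_comm (w w' v : V) :
    leviCivita E M (frame Φ w) (Φ v) (frame Φ w' (Φ v)) =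
      leviCivita E M (frame Φ w') (Φ v) (frame Φ w (Φ v)) := by
  have := leviCivita_sub_leviCivita (mdifferentiableAt_frame Φ w' (Φ v))
    (mdifferentiableAt_frame Φ w (Φ v))
  rw [mlieBracket_frame_frame, sub_eq_zero] at this
  exact this

/-- The geodesic equation for the rays: `∇_P P = P` for the radial field `P`. -/
theorem IsPolarDiffeo.leviCivita_radial (h : IsPolarDiffeo Φ) (v : V) :
    leviCivita E M (radial Φ) (Φ v) (radial Φ (Φ v)) = radial Φ (Φ v) := by
  have hg := (h.isGeodesic v).covDerivAlong_velocity 1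
  have hγ := ((h.isGeodesic v).contMDiff.mdifferentiable (by simp)) 1
  -- the velocity of the ray is `s⁻¹ P`, and `D(s⁻¹ P)/ds = -P + ∇_P P` at `s = 1`
  have hev : ∀ᶠ s in nhds (1 : ℝ), velocity (E := E) (fun t : ℝ ↦ Φ (t • v)) s =
      s⁻¹ • radial Φ (Φ (s • v)) := by
    filter_upwards [eventually_ne_nhds (one_ne_zero (α := ℝ))] with s hs
    rw [velocity_ray, radial_smul, smul_smul, inv_mul_cancel₀ hs, one_smul]
  rw [covDerivAlong_of_eventuallyEq_smul hγ (by fun_prop (disch := norm_num))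
    (mdifferentiableAt_radial _) hev, velocity_ray] at hg
  have hd : deriv (fun s : ℝ ↦ s⁻¹) 1 = -1 := by simp
  rw [hd] at hg
  have h2 : frame Φ v (Φ ((1 : ℝ) • v)) = radial Φ (Φ ((1 : ℝ) • v)) := by
    rw [radial_smul, one_smul ℝ (frame Φ v _)]
  rw [h2, inv_one, neg_one_smul, one_smul ℝ (leviCivita E M _ _ _), neg_add_eq_zero,
    one_smul ℝ v] at hg
  exact hg.symm

theorem hasDerivAt_comp_ray {h : M → ℝ} {v : V} {t : ℝ} (hh : MDiffAt h (Φ (t • v))) :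
    HasDerivAt (fun t : ℝ ↦ h (Φ (t • v)))
      (mvfderiv 𝓘(ℝ, E) h (Φ (t • v)) (frame Φ v (Φ (t • v)))) t := by
  have h1 : HasDerivAt (fun t : ℝ ↦ t • v) v t := by
    simpa using (hasDerivAt_id t).smul_const v
  have h2 : DifferentiableAt ℝ (h ∘ Φ) (t • v) :=
    (hh.comp (t • v) (Φ.mdifferentiable (by simp) _)).differentiableAt
  rw [frame, mvfderiv_pushField Φ hh]
  exact h2.hasFDerivAt.comp_hasDerivAt t h1

/-- Derivative along a ray, multiplied by the parameter, as a derivative along the radial field. -/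
theorem hasDerivAt_comp_ray_radial {h : M → ℝ} {v : V} {t : ℝ} (ht : t ≠ 0)
    (hh : MDiffAt h (Φ (t • v))) : HasDerivAt (fun t : ℝ ↦ h (Φ (t • v)))
      (t⁻¹ * mvfderiv 𝓘(ℝ, E) h (Φ (t • v)) (radial Φ (Φ (t • v)))) t := by
  have := hasDerivAt_comp_ray hh
  rwa [radial_smul, map_smul, smul_eq_mul, inv_mul_cancel_left₀ ht]

theorem mdifferentiableAt_inner_frame (Φ : Diffeomorph 𝓘(ℝ, V) 𝓘(ℝ, E) V M ∞) (w w' : V) (x : M) :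
    MDiffAt (fun y ↦ (inner ℝ (frame Φ w y) (frame Φ w' y) : ℝ)) x :=
  mdiff_inner (mdifferentiableAt_frame Φ w x) (mdifferentiableAt_frame Φ w' x)

/-- The rays have constant speed. -/
theorem IsPolarDiffeo.inner_frame_self (h : IsPolarDiffeo Φ) (v : V) :
    (inner ℝ (frame Φ v (Φ v)) (frame Φ v (Φ v)) : ℝ) = ‖v‖ ^ 2 := by
  have hd (t : ℝ) := hasDerivAt_comp_ray (mdifferentiableAt_inner_frame Φ v v (Φ (t • v)))
  obtain ⟨c, hc, hc'⟩ := exists_hasDerivAt_eq_slope _ _ (zero_lt_one (α := ℝ))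
    (fun t _ ↦ (hd t).continuousAt.continuousWithinAt) (fun t _ ↦ hd t)
  -- the derivative vanishes at the intermediate point, since `frame Φ v` is `c⁻¹ P` there
  have hfr : frame Φ v (Φ (c • v)) = c⁻¹ • radial Φ (Φ (c • v)) := by
    rw [radial_smul, inv_smul_smul₀ hc.1.ne']
  have hz : leviCivita E M (frame Φ v) (Φ (c • v)) (frame Φ v (Φ (c • v))) = 0 := by
    conv_lhs => enter [2]; rw [hfr]
    rw [ContinuousLinearMap.map_smul, leviCivita_frame_radial, hfr, ContinuousLinearMap.map_smul,
      h.leviCivita_radial, sub_self, smul_zero]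
  rw [mvfderiv_inner (mdifferentiableAt_frame Φ v _) (mdifferentiableAt_frame Φ v _), hz] at hc'
  have h0 := h.norm_velocity v
  rw [velocity_ray] at h0
  rw [inner_zero_left, inner_zero_right, add_zero, sub_zero, div_one, one_smul ℝ v,
    real_inner_self_eq_norm_sq (frame Φ v (Φ ((0 : ℝ) • v))), h0] at hc'
  exact sub_eq_zero.1 hc'.symm

/-- The Gauss lemma. -/
theorem IsPolarDiffeo.inner_radial_frame (h : IsPolarDiffeo Φ) (v w : V) :
    (inner ℝ (radial Φ (Φ v)) (frame Φ w (Φ v)) : ℝ) = inner ℝ v w := by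
  have hPP : (fun y ↦ (inner ℝ (radial Φ y) (radial Φ y) : ℝ)) ∘ Φ = fun v ↦ ‖v‖ ^ 2 := by
    ext v
    rw [Function.comp_apply, radial_apply, h.inner_frame_self]
  have hdiff (u : V) := mdiff_inner (mdifferentiableAt_radial (Φ := Φ) u)
    (mdifferentiableAt_frame Φ w (Φ u))
  have hd (t : ℝ) := hasDerivAt_comp_ray (hdiff (t • v))
  -- `P⟪P,W⟫ = ⟪P,W⟫ + ⟪P,∇_W P - W⟫ = W|P|²/2`, and `|P|² = ‖·‖²` in the chart `Φ`
  have key (u : V) : mvfderiv 𝓘(ℝ, E) (fun y ↦ (inner ℝ (radial Φ y) (frame Φ w y) : ℝ)) (Φ u)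
      (radial Φ (Φ u)) = inner ℝ u w := by
    have h1 := mvfderiv_pushField Φ (mdiff_inner (mdifferentiableAt_radial (Φ := Φ) u)
      (mdifferentiableAt_radial u)) (fun _ ↦ w)
    rw [hPP, mvfderiv_inner (mdifferentiableAt_radial u) (mdifferentiableAt_radial u),
      real_inner_comm (radial Φ (Φ u)), fderiv_norm_sq_apply] at h1
    rw [mvfderiv_inner (mdifferentiableAt_radial u) (mdifferentiableAt_frame Φ w _),
      h.leviCivita_radial, leviCivita_frame_radial, inner_sub_right]
    simp only [frame, smul_apply, innerSL_apply_apply, nsmul_eq_mul] at h1 ⊢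
    simp at h1
    linarith
  obtain ⟨c, hc, hc'⟩ := exists_hasDerivAt_eq_slope _ _ (zero_lt_one (α := ℝ))
    (fun t _ ↦ (hd t).continuousAt.continuousWithinAt) (fun t _ ↦ hd t)
  -- along the ray `⟪P,W⟫` thus has constant derivative `⟪v,w⟫`, and it vanishes at the pole
  have h2 := key (c • v)
  rw [radial_smul, map_smul, hc', inner_smul_left] at h2
  have h3 := mul_left_cancel₀ hc.1.ne' h2
  have h4 : radial Φ (Φ ((0 : ℝ) • v)) = 0 := by
    rw [radial_smul, zero_smul ℝ (frame Φ v _)]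
  rw [h4, inner_zero_left, sub_zero, sub_zero, div_one, one_smul ℝ v] at h3
  exact h3

theorem IsPolarDiffeo.inner_radial_radial (h : IsPolarDiffeo Φ) (v : V) :
    (inner ℝ (radial Φ (Φ v)) (radial Φ (Φ v)) : ℝ) = ‖v‖ ^ 2 := by
  rw [radial_apply, h.inner_frame_self]

theorem IsPolarDiffeo.norm_radial (h : IsPolarDiffeo Φ) (v : V) : ‖radial Φ (Φ v)‖ = ‖v‖ := by
  have := h.inner_radial_radial v
  rw [real_inner_self_eq_norm_sq] at this
  exact (sq_eq_sq₀ (norm_nonneg _) (norm_nonneg _)).1 this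

/-- The covariant derivative of the radial field is self-adjoint: it is the Hessian of half the
squared distance. -/
theorem IsPolarDiffeo.inner_leviCivita_radial_comm (h : IsPolarDiffeo Φ) (v w w' : V) :
    (inner ℝ (leviCivita E M (radial Φ) (Φ v) (frame Φ w (Φ v))) (frame Φ w' (Φ v)) : ℝ) =
      inner ℝ (leviCivita E M (radial Φ) (Φ v) (frame Φ w' (Φ v))) (frame Φ w (Φ v)) := by
  have key (w w' : V) : (inner ℝ (leviCivita E M (radial Φ) (Φ v) (frame Φ w (Φ v)))
      (frame Φ w' (Φ v)) : ℝ) + inner ℝ (radial Φ (Φ v))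
        (leviCivita E M (frame Φ w') (Φ v) (frame Φ w (Φ v))) = inner ℝ w w' := by
    rw [← mvfderiv_inner (mdifferentiableAt_radial v) (mdifferentiableAt_frame Φ w' _)]
    have h1 := mvfderiv_pushField Φ (mdiff_inner (mdifferentiableAt_radial (Φ := Φ) v)
      (mdifferentiableAt_frame Φ w' (Φ v))) (fun _ ↦ w)
    have h2 : (fun y ↦ (inner ℝ (radial Φ y) (frame Φ w' y) : ℝ)) ∘ Φ = fun v ↦ inner ℝ v w' := by
      ext v
      exact h.inner_radial_frame v w'
    refine h1.trans ?_
    rw [h2, fderiv_inner_apply ℝ differentiableAt_fun_id (differentiableAt_const w')]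
    simp
  have h1 := key w w'
  have h2 := key w' w
  rw [leviCivita_frame_comm, real_inner_comm w'] at h1
  linarith

end Polar

/-! ### The Riccati equation and its comparison -/

/-- A first-time argument: a continuous family of symmetric bilinear forms that starts positive
definite stays so if, whenever it has a null vector `w`, its value at `(w, w)` is increasing. -/
theorem pos_of_deriv_pos_of_null {V : Type*} [NormedAddCommGroup V] [NormedSpace ℝ V]
    [FiniteDimensional ℝ V] {Q : ℝ → V →L[ℝ] V →L[ℝ] ℝ} (hcont : Continuous fun q : ℝ × V ↦ Q q.1 q.2 q.2)
    (hsymm : ∀ t w w', Q t w w' = Q t w' w) (h0 : ∀ w ≠ 0, 0 < Q 0 w w)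
    (hd : ∀ t : ℝ, 0 < t → t ≤ 1 → ∀ w ≠ 0, (∀ w', Q t w w' = 0) →
      ∃ d > 0, HasDerivAt (fun s ↦ Q s w w) d t)
    {t : ℝ} (ht : t ∈ Set.Icc (0 : ℝ) 1) {w : V} (hw : w ≠ 0) : 0 < Q t w w := by
  by_contra! hneg
  -- the unit vectors at which positivity fails; take one at the first time
  let A : Set (ℝ × V) := {q | q ∈ Set.Icc (0 : ℝ) 1 ×ˢ Metric.sphere (0 : V) 1 ∧ Q q.1 q.2 q.2 ≤ 0}
  have hA : IsCompact A := (isCompact_Icc.prod (isCompact_sphere 0 1)).inter_right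
    (isClosed_le hcont continuous_const)
  have hscale (s : ℝ) (w : V) (hw : w ≠ 0) : Q s (‖w‖⁻¹ • w) (‖w‖⁻¹ • w) = ‖w‖⁻¹ ^ 2 * Q s w w := by
    simp; ring
  have hmem {s : ℝ} (hs : s ∈ Set.Icc (0 : ℝ) 1) {w : V} (hw : w ≠ 0) (hn : Q s w w ≤ 0) :
      (s, ‖w‖⁻¹ • w) ∈ A := by
    refine ⟨⟨hs, ?_⟩, ?_⟩
    · simp [norm_smul, hw]
    · change Q s (‖w‖⁻¹ • w) (‖w‖⁻¹ • w) ≤ 0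
      rw [hscale s w hw]
      exact mul_nonpos_of_nonneg_of_nonpos (by positivity) hn
  obtain ⟨⟨t₀, w₀⟩, hq, hmin⟩ := hA.exists_isMinOn ⟨_, hmem ht hw hneg⟩ continuous_fst.continuousOn
  obtain ⟨⟨ht₀, hw₀⟩, hn₀⟩ := hq
  simp only at ht₀ hw₀ hn₀
  have hw₀' : w₀ ≠ 0 := by
    rintro rfl
    simp at hw₀
  have hbefore {s : ℝ} (hs : 0 ≤ s) (hst : s < t₀) {w : V} (hw : w ≠ 0) : 0 < Q s w w := by
    by_contra! hn
    have := hmin (hmem ⟨hs, hst.le.trans ht₀.2⟩ hw hn)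
    exact absurd hst (not_lt.2 this)
  have ht₀pos : 0 < t₀ := by
    rcases ht₀.1.eq_or_lt with h | h
    · rw [← h] at hn₀
      exact absurd hn₀ (not_le.2 (h0 w₀ hw₀'))
    · exact h
  have hleft : ∀ᶠ s in nhdsWithin t₀ (Set.Iio t₀), 0 ≤ s ∧ s < t₀ := by
    filter_upwards [self_mem_nhdsWithin, mem_nhdsWithin_of_mem_nhds (lt_mem_nhds ht₀pos)] with s h1 h2
    exact ⟨h2.le, h1⟩
  have hsemi (w : V) : 0 ≤ Q t₀ w w := by
    by_cases hw : w = 0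
    · simp [hw]
    have hc : Filter.Tendsto (fun s ↦ Q s w w) (nhdsWithin t₀ (Set.Iio t₀)) (nhds (Q t₀ w w)) := by
      have : Continuous fun s ↦ Q s w w := hcont.comp (continuous_id.prodMk continuous_const)
      exact this.continuousWithinAt
    exact ge_of_tendsto hc (hleft.mono fun s hs ↦ (hbefore hs.1 hs.2 hw).le)
  have hnull : Q t₀ w₀ w₀ = 0 := le_antisymm hn₀ (hsemi w₀)
  -- an isotropic vector of a semidefinite form is in its kernel
  have hker (w' : V) : Q t₀ w₀ w' = 0 := by
    have hquad (s : ℝ) : 0 ≤ Q t₀ w' w' * (s * s) + 2 * Q t₀ w₀ w' * s + 0 := by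
      have := hsemi (w₀ + s • w')
      simp only [map_add, map_smul, add_apply, smul_apply, smul_eq_mul, hnull,
        hsymm t₀ w' w₀] at this
      linarith
    have := discrim_le_zero hquad
    rw [discrim] at this
    nlinarith [sq_nonneg (Q t₀ w₀ w')]
  obtain ⟨d, hdpos, hder⟩ := hd t₀ ht₀pos ht₀.2 w₀ hw₀' hker
  -- an increasing function that vanishes at `t₀` is negative just before
  have hslope := (hasDerivAt_iff_tendsto_slope.1 hder).mono_left
    (nhdsWithin_mono t₀ (fun s (hs : s ∈ Set.Iio t₀) ↦ ne_of_lt hs))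
  obtain ⟨s, hs1, hs2⟩ := ((hslope.eventually (lt_mem_nhds hdpos)).and hleft).exists
  rw [slope_def_field, hnull, sub_zero] at hs1
  exact absurd hs1 (not_lt.2 (div_nonpos_of_nonneg_of_nonpos (hbefore hs2.1 hs2.2 hw₀').le
    (sub_nonpos.2 hs2.2.le)))

section Comparison

variable {E : Type*} [NormedAddCommGroup E] [NormedSpace ℝ E] [FiniteDimensional ℝ E]
  {M : Type*} [TopologicalSpace M] [ChartedSpace E M] [IsManifold 𝓘(ℝ, E) ∞ M]
  [RiemannianBundle (fun x : M ↦ TangentSpace 𝓘(ℝ, E) x)]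
  [IsContMDiffRiemannianBundle 𝓘(ℝ, E) ∞ E (fun x : M ↦ TangentSpace 𝓘(ℝ, E) x)]
  {V : Type*} [NormedAddCommGroup V] [InnerProductSpace ℝ V] [FiniteDimensional ℝ V]
  {Φ : Diffeomorph 𝓘(ℝ, V) 𝓘(ℝ, E) V M ∞}

/-- The pull-back to `V` of the bilinear form `⟪∇_X P, Y⟫`, where `P` is the radial field; it is the
Hessian of half the squared distance from the pole. -/
def shape (Φ : Diffeomorph 𝓘(ℝ, V) 𝓘(ℝ, E) V M ∞) (v : V) : V →L[ℝ] V →L[ℝ] ℝ :=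
  LinearMap.toContinuousBilinearMap <| LinearMap.mk₂ ℝ
    (fun w w' : V ↦
      (inner ℝ (leviCivita E M (radial Φ) (Φ v) (frame Φ w (Φ v))) (frame Φ w' (Φ v)) : ℝ))
    (fun _ _ _ ↦ by simp [frame_add, inner_add_left])
    (fun _ _ _ ↦ by simp [frame_smul, inner_smul_left])
    (fun _ _ _ ↦ by simp [frame_add, inner_add_right])
    (fun _ _ _ ↦ by simp [frame_smul, inner_smul_right])

theorem shape_apply (v w w' : V) : shape Φ v w w' =
    inner ℝ (leviCivita E M (radial Φ) (Φ v) (frame Φ w (Φ v))) (frame Φ w' (Φ v)) := rfl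

theorem continuous_shape : Continuous (shape Φ) := by
  suffices ContDiff ℝ 0 (shape Φ) from this.continuous
  rw [contDiff_iff_contDiffAt]
  intro v
  refine contDiffAt_clm_apply fun w ↦ contDiffAt_clm_apply fun w' ↦ ?_
  exact contDiffAt_comp_diffeo Φ (by norm_cast) (cmdiffAt_inner (n := 0)
    (contMDiffAt_leviCivita_frame Φ (n := 0) (contMDiffAt_radial v (by norm_cast)) w)
    (contMDiffAt_frame Φ w' _ (by norm_cast)))

/-- First variation of the metric along a ray: `P⟪W,W⟫ = 2⟪∇_P W,W⟫` with `∇_P W = ∇_W P - W`. -/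
theorem hasDerivAt_gram_ray (v w : V) {t : ℝ} (ht : t ≠ 0) :
    HasDerivAt (fun t : ℝ ↦ gram Φ (t • v) w w)
      (t⁻¹ * (2 * shape Φ (t • v) w w - 2 * gram Φ (t • v) w w)) t := by
  refine (hasDerivAt_comp_ray_radial ht (mdifferentiableAt_inner_frame Φ w w _)).congr_deriv ?_
  rw [mvfderiv_inner (mdifferentiableAt_frame Φ w _) (mdifferentiableAt_frame Φ w _),
    leviCivita_frame_radial, inner_sub_left, inner_sub_right, shape_apply, gram_apply,
    real_inner_comm (frame Φ w (Φ (t • v)))]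
  ring

/-- The Riccati equation along a ray. For a frame field `W` the Jacobi equation takes the form
`∇_P ∇_W P = R(P,W)P`, since `∇_P P = P` and `[P,W] = -W`. -/
theorem IsPolarDiffeo.hasDerivAt_shape_ray (h : IsPolarDiffeo Φ) (v w : V) {t : ℝ} (ht : t ≠ 0) :
    HasDerivAt (fun t : ℝ ↦ shape Φ (t • v) w w)
      (t⁻¹ * (inner ℝ (curvatureField (radial Φ) (frame Φ w) (radial Φ) (Φ (t • v)))
          (frame Φ w (Φ (t • v)))
        + inner ℝ (leviCivita E M (radial Φ) (Φ (t • v)) (frame Φ w (Φ (t • v))))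
          (leviCivita E M (radial Φ) (Φ (t • v)) (frame Φ w (Φ (t • v))))
        - shape Φ (t • v) w w)) t := by
  have hd : MDiffAt (T% (fun y ↦ leviCivita E M (radial Φ) y (frame Φ w y))) (Φ (t • v)) :=
    mdifferentiableAt_leviCivita Φ (contMDiffAt_radial _ (by norm_cast)) (mdifferentiableAt_frame ..)
  refine (hasDerivAt_comp_ray_radial ht
    (mdiff_inner hd (mdifferentiableAt_frame Φ w _))).congr_deriv ?_
  have hPP : (fun y ↦ leviCivita E M (radial Φ) y (radial Φ y)) = radial Φ := by
    ext y
    obtain ⟨u, hu⟩ := Φ.surjective y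
    replace hu : Φ u = y := hu
    subst hu
    exact h.leviCivita_radial u
  have hR : curvatureField (radial Φ) (frame Φ w) (radial Φ) (Φ (t • v)) =
      leviCivita E M (fun y ↦ leviCivita E M (radial Φ) y (frame Φ w y)) (Φ (t • v))
        (radial Φ (Φ (t • v))) := by
    rw [curvatureField, hPP, mlieBracket_swap_apply, mlieBracket_frame_radial, map_neg]
    abel
  rw [mvfderiv_inner hd (mdifferentiableAt_frame Φ w _), hR, leviCivita_frame_radial,
    inner_sub_right, shape_apply]
  ring

theorem IsPolarDiffeo.norm_frame_ray (h : IsPolarDiffeo Φ) (v : V) (t : ℝ) :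
    ‖frame Φ v (Φ (t • v))‖ = ‖v‖ := by
  rcases eq_or_ne t 0 with rfl | ht
  · rw [← velocity_ray, h.norm_velocity]
  · have h1 := h.norm_radial (t • v)
    rw [radial_smul, norm_smul, norm_smul] at h1
    exact mul_left_cancel₀ (norm_ne_zero_iff.2 ht) h1

theorem IsPolarDiffeo.isRadialVector (h : IsPolarDiffeo Φ) {v : V} (hv : v ≠ 0) :
    IsRadialVector (Φ 0) (Φ v) (‖v‖⁻¹ • radial Φ (Φ v)) := by
  have hn : ‖v‖ ≠ 0 := norm_ne_zero_iff.2 hv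
  have hu : ‖(‖v‖⁻¹ • v)‖ = 1 := by rw [norm_smul, norm_inv, norm_norm, inv_mul_cancel₀ hn]
  refine ⟨fun t ↦ Φ (t • (‖v‖⁻¹ • v)), ‖v‖, h.isGeodesic _, fun t ↦ ?_, norm_pos_iff.2 hv, ?_, ?_⟩
  · rw [velocity_ray, h.norm_frame_ray, hu]
  · exact congrArg Φ (zero_smul ℝ _)
  · have key (y : V) (hy : y = v) : (⟨Φ y, frame Φ (‖v‖⁻¹ • v) (Φ y)⟩ : TangentBundle 𝓘(ℝ, E) M) =
        ⟨Φ v, ‖v‖⁻¹ • radial Φ (Φ v)⟩ := by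
      subst hy
      rw [frame_smul, radial_apply]
      rfl
    rw [velocity_ray]
    exact key _ (smul_inv_smul₀ hn v)

theorem linearIndependent_frame {v w w' : V} (hw : LinearIndependent ℝ ![w, w']) :
    LinearIndependent ℝ ![frame Φ w (Φ v), frame Φ w' (Φ v)] := by
  rw [LinearIndependent.pair_iff] at hw ⊢
  intro a b hab
  refine hw a b ((frame_eq_zero_iff Φ (v := v)).1 ?_)
  rw [frame_add, frame_smul, frame_smul]
  exact hab

/-- The radial curvature bound, in the form in which it enters the Riccati equation. -/
theorem IsPolarDiffeo.inner_curvatureField_le (h : IsPolarDiffeo Φ) {K : ℝ}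
    (hcurv : RadialCurvatureGE E (Φ 0) (-K ^ 2)) {v w : V} (hv : v ≠ 0)
    (hvw : LinearIndependent ℝ ![v, w]) :
    (inner ℝ (curvatureField (radial Φ) (frame Φ w) (radial Φ) (Φ v)) (frame Φ w (Φ v)) : ℝ) ≤
      K ^ 2 * ‖v‖ ^ 2 * gram Φ v w w := by
  have hr : 0 < ‖v‖ := norm_pos_iff.2 hv
  have hx : Φ v ≠ Φ 0 := fun e ↦ hv (Φ.injective e)
  set τ : TangentSpace 𝓘(ℝ, E) (Φ v) := ‖v‖⁻¹ • radial Φ (Φ v) with hτ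
  set η : TangentSpace 𝓘(ℝ, E) (Φ v) := frame Φ w (Φ v) with hη
  have hli : LinearIndependent ℝ ![τ, η] := by
    have h1 := linearIndependent_frame (Φ := Φ) (v := v) hvw
    rw [LinearIndependent.pair_iff] at h1 ⊢
    intro a b hab
    have h2 := h1 (a * ‖v‖⁻¹) b (by rw [← hab, hτ, radial_apply, smul_smul])
    exact ⟨(mul_eq_zero.1 h2.1).resolve_right (inv_ne_zero hr.ne'), h2.2⟩
  have hsec := hcurv (Φ v) τ η hx (h.isRadialVector hv) hli
  have hτ1 : ‖τ‖ = 1 := by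
    rw [hτ, norm_smul, norm_inv, norm_norm, h.norm_radial, inv_mul_cancel₀ hr.ne']
  have hD : 0 < ‖τ‖ ^ 2 * ‖η‖ ^ 2 - (inner ℝ τ η) ^ 2 := by
    have h3 : η - (inner ℝ τ η : ℝ) • τ ≠ 0 := by
      intro h0
      rw [LinearIndependent.pair_iff] at hli
      have := hli (-(inner ℝ τ η : ℝ)) 1 (by rw [one_smul, neg_smul, neg_add_eq_sub, h0])
      exact one_ne_zero this.2
    have h4 : ‖η - (inner ℝ τ η : ℝ) • τ‖ ^ 2 = ‖η‖ ^ 2 - (inner ℝ τ η) ^ 2 := by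
      rw [norm_sub_sq_real, norm_smul, hτ1, inner_smul_right, real_inner_comm τ η]
      simp
      ring
    have h5 : 0 < ‖η - (inner ℝ τ η : ℝ) • τ‖ ^ 2 := by positivity
    rw [hτ1]
    linarith
  -- pass from the frozen extensions in the definition of `curvature` to the fields `P` and `W`
  have hN : (inner ℝ (curvature (Φ v) τ η η) τ : ℝ) = - (‖v‖⁻¹ ^ 2 *
      inner ℝ (curvatureField (radial Φ) (frame Φ w) (radial Φ) (Φ v)) η) := by
    have hP : MDiffAt (T% (radial Φ)) (Φ v) := mdifferentiableAt_radial v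
    have hW := mdifferentiableAt_frame Φ w (Φ v)
    have hext : CMDiffAt 2 (T% (extend E η)) (Φ v) :=
      (contMDiffAt_extend 𝓘(ℝ, E) E η).of_le (n := ∞) (by norm_cast)
    have e1 : curvature (Φ v) τ η η =
        ‖v‖⁻¹ • curvatureField (radial Φ) (frame Φ w) (extend E η) (Φ v) := by
      rw [curvature, ← (tensorialAt_curvatureField_left Φ (Y := frame Φ w) hext).smul
        (f := fun _ ↦ ‖v‖⁻¹) mdifferentiableAt_const hP]
      refine curvatureField_congr Φ (mdifferentiableAt_extend ..)
        (mdifferentiableAt_const.smul_section hP) (mdifferentiableAt_extend ..) hW hext ?_ ?_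
      · simp [hτ]
      · simp [hη]
    have e2 := inner_curvatureField_skew Φ (contMDiffAt_radial v (by norm_cast))
      (contMDiffAt_frame Φ w (Φ v) (by norm_cast)) hext
      (contMDiffAt_radial v (by norm_cast))
    rw [extend_apply_self] at e2
    rw [e1, hτ, inner_smul_left, inner_smul_right, e2]
    simp
    ring
  rw [sectionalCurvature, le_div_iff₀ hD, hN, hτ1] at hsec
  have hfin : ‖v‖⁻¹ ^ 2 * inner ℝ (curvatureField (radial Φ) (frame Φ w) (radial Φ) (Φ v)) η ≤
      K ^ 2 * ‖η‖ ^ 2 := by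
    nlinarith [mul_nonneg (sq_nonneg K) (sq_nonneg (inner ℝ τ η : ℝ))]
  rw [gram_apply, ← hη, real_inner_self_eq_norm_sq]
  calc _ = ‖v‖ ^ 2 * (‖v‖⁻¹ ^ 2 *
        inner ℝ (curvatureField (radial Φ) (frame Φ w) (radial Φ) (Φ v)) η) := by
        field_simp
    _ ≤ ‖v‖ ^ 2 * (K ^ 2 * ‖η‖ ^ 2) := by gcongr
    _ = _ := by ring

/-- Comparison for the Hessian of half the squared distance: along the ray through `v`, the form
`(1 + K ‖v‖ t + ε) g` is a strict supersolution of the Riccati equation, and at `t = 0` it exceeds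
`shape`, which is the metric there. -/
theorem IsPolarDiffeo.shape_le (h : IsPolarDiffeo Φ) {K : ℝ} (hK : 0 ≤ K)
    (hcurv : RadialCurvatureGE E (Φ 0) (-K ^ 2)) {v : V} (hv : v ≠ 0) (w : V) :
    shape Φ v w w ≤ (1 + K * ‖v‖) * gram Φ v w w := by
  have hr : 0 < ‖v‖ := norm_pos_iff.2 hv
  have hgpos (u : V) {w : V} (hw : w ≠ 0) : 0 < gram Φ u w w := by
    rw [gram_apply]
    exact real_inner_self_pos.2 ((frame_eq_zero_iff Φ).not.2 hw)
  by_cases hw : w = 0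
  · simp [hw]
  refine le_of_forall_pos_le_add fun δ hδ ↦ ?_
  obtain ⟨ε, hε, hεδ⟩ : ∃ ε > 0, ε * gram Φ v w w = δ :=
    ⟨δ / gram Φ v w w, div_pos hδ (hgpos v hw), div_mul_cancel₀ _ (hgpos v hw).ne'⟩
  let m : ℝ → ℝ := fun t ↦ 1 + K * ‖v‖ * t + ε
  let Q : ℝ → V →L[ℝ] V →L[ℝ] ℝ := fun t ↦ m t • gram Φ (t • v) - shape Φ (t • v)
  have hQdef (t : ℝ) (w w' : V) : Q t w w' =
      m t * gram Φ (t • v) w w' - shape Φ (t • v) w w' := by simp [Q]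
  have hQc : Continuous fun q : ℝ × V ↦ Q q.1 q.2 q.2 := by
    simp only [hQdef]
    have h1 : Continuous (gram Φ) := (contDiff_gram Φ 0).continuous
    have h2 : Continuous (shape Φ) := continuous_shape
    have h3 : Continuous fun q : ℝ × V ↦ q.1 • v := continuous_fst.smul continuous_const
    have h4 : Continuous fun q : ℝ × V ↦ m q.1 := by fun_prop
    exact (h4.mul (((h1.comp h3).clm_apply continuous_snd).clm_apply continuous_snd)).sub
      (((h2.comp h3).clm_apply continuous_snd).clm_apply continuous_snd)
  have hQs (t : ℝ) (w w' : V) : Q t w w' = Q t w' w := by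
    rw [hQdef, hQdef, shape_apply, shape_apply, h.inner_leviCivita_radial_comm, gram_apply,
      gram_apply, real_inner_comm]
  have hQ0 (w : V) (hw : w ≠ 0) : 0 < Q 0 w w := by
    have h1 : shape Φ ((0 : ℝ) • v) w w = gram Φ ((0 : ℝ) • v) w w := by
      have h2 := leviCivita_frame_radial (Φ := Φ) w ((0 : ℝ) • v)
      rw [radial_smul, zero_smul ℝ (frame Φ v _), map_zero] at h2
      have h3 := sub_eq_zero.1 h2.symm
      rw [shape_apply, gram_apply, h3]
    rw [hQdef, h1]
    have := hgpos ((0 : ℝ) • v) hw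
    simp only [m]
    nlinarith [mul_pos hε this]
  have hd (t : ℝ) (ht : 0 < t) (_ : t ≤ 1) (w : V) (hw : w ≠ 0) (hker : ∀ w', Q t w w' = 0) :
      ∃ d > 0, HasDerivAt (fun s ↦ Q s w w) d t := by
    have hg := hgpos (t • v) hw
    have htv : t • v ≠ 0 := smul_ne_zero ht.ne' hv
    have hm1 : 1 < m t := by
      have : 0 ≤ K * ‖v‖ * t := by positivity
      simp only [m]; linarith
    -- a null vector of `m g - shape` is an eigenvector of `∇P`
    have hS : leviCivita E M (radial Φ) (Φ (t • v)) (frame Φ w (Φ (t • v))) =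
        m t • frame Φ w (Φ (t • v)) := by
      refine ext_inner_right ℝ fun z ↦ ?_
      obtain ⟨w', hw'⟩ := exists_frame_eq Φ z
      have := hker w'
      rw [hQdef, shape_apply, gram_apply, sub_eq_zero] at this
      rw [← hw', ← this, inner_smul_left]
      rfl
    have hs : shape Φ (t • v) w w = m t * gram Φ (t • v) w w := by
      have := hker w
      rw [hQdef] at this
      linarith
    -- it is not radial, because `∇_P P = P` while `m > 1`
    have hli : LinearIndependent ℝ ![t • v, w] := by
      rw [LinearIndependent.pair_iff' htv]
      intro c hc
      have h1 : frame Φ w (Φ (t • v)) = c • radial Φ (Φ (t • v)) := by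
        rw [← hc, frame_smul, radial_apply]
        rfl
      have h2 : leviCivita E M (radial Φ) (Φ (t • v)) (frame Φ w (Φ (t • v))) =
          frame Φ w (Φ (t • v)) := by
        rw [h1, ContinuousLinearMap.map_smul, h.leviCivita_radial]
      rw [shape_apply, h2, ← gram_apply] at hs
      nlinarith
    have hcu := h.inner_curvatureField_le hcurv htv hli
    have hder := ((((hasDerivAt_id t).const_mul (K * ‖v‖)).const_add (1 + ε)).mul
      (hasDerivAt_gram_ray (Φ := Φ) v w ht.ne')).sub (h.hasDerivAt_shape_ray v w ht.ne')
    refine ⟨_, ?_, hder.congr_of_eventuallyEq (Filter.Eventually.of_forall fun s ↦ ?_)⟩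
    · rw [hS, hs, inner_smul_left, inner_smul_right, ← gram_apply]
      rw [norm_smul, Real.norm_of_nonneg ht.le] at hcu
      have hm : m t = 1 + ε + K * ‖v‖ * t := by simp only [m]; ring
      set R := (inner ℝ (curvatureField (radial Φ) (frame Φ w) (radial Φ) (Φ (t • v)))
          (frame Φ w (Φ (t • v))) : ℝ)
      set g := gram Φ (t • v) w w
      have hpos : 0 < t * (K * ‖v‖) * g + (m t * m t - m t) * g - R := by
        have h6 : 0 ≤ K * ‖v‖ * t := by positivity
        have h7 : R ≤ (K * ‖v‖ * t) ^ 2 * g := by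
          calc R ≤ _ := hcu
            _ = _ := by ring
        rw [hm]
        nlinarith [mul_pos hε hg, mul_nonneg h6 hg.le, mul_pos (mul_pos hε hε) hg,
          mul_nonneg (mul_nonneg h6 hε.le) hg.le]
      have : 0 < t⁻¹ * (t * (K * ‖v‖) * g + (m t * m t - m t) * g - R) := by positivity
      refine this.trans_eq ?_
      simp only [id, hm, conj_trivial]
      field_simp
      ring
    · change Q s w w = _
      rw [hQdef]
      simp only [m, Pi.sub_apply, Pi.mul_apply, id]
      ring
  have := pos_of_deriv_pos_of_null hQc hQs hQ0 hd (t := 1) (by simp) hw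
  rw [hQdef, one_smul ℝ v] at this
  simp only [m] at this
  linarith

end Comparison

/-! ### The distance from the pole -/

section Distance

variable {E : Type*} [NormedAddCommGroup E] [NormedSpace ℝ E] [FiniteDimensional ℝ E]
  {M : Type*} [TopologicalSpace M] [ChartedSpace E M] [IsManifold 𝓘(ℝ, E) ∞ M]
  [RiemannianBundle (fun x : M ↦ TangentSpace 𝓘(ℝ, E) x)]

/-- A function whose differential has norm at most one is `1`-Lipschitz for the Riemannian
distance. -/
theorem enorm_sub_le_riemannianEDist {k : M → ℝ} (hk : ContMDiff 𝓘(ℝ, E) 𝓘(ℝ) 1 k)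
    (hle : ∀ (x : M) (u : TangentSpace 𝓘(ℝ, E) x), ‖mvfderiv 𝓘(ℝ, E) k x u‖ ≤ ‖u‖) (x y : M) :
    ‖k y - k x‖ₑ ≤ riemannianEDist 𝓘(ℝ, E) x y := by
  refine le_of_forall_gt fun r hr ↦ ?_
  obtain ⟨γ, rfl, rfl, hγ, hlen⟩ := exists_lt_of_riemannianEDist_lt hr
  refine lt_of_le_of_lt ?_ hlen
  have hkγ : ContDiffOn ℝ 1 (k ∘ γ) (Set.Icc 0 1) :=
    contMDiffOn_iff_contDiffOn.1 (hk.comp_contMDiffOn hγ)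
  refine (enorm_sub_le_lintegral_deriv_of_contDiffOn_Icc hkγ zero_le_one).trans ?_
  rw [pathELength_eq_lintegral_mfderiv_Ioo, ← MeasureTheory.restrict_Ioo_eq_restrict_Icc]
  refine MeasureTheory.setLIntegral_mono' measurableSet_Ioo fun t ht ↦ ?_
  have hγt : MDifferentiableAt 𝓘(ℝ, ℝ) 𝓘(ℝ, E) γ t :=
    (hγ.contMDiffAt (Icc_mem_nhds ht.1 ht.2)).mdifferentiableAt one_ne_zero
  have hder : deriv (k ∘ γ) t =
      mvfderiv 𝓘(ℝ, E) k (γ t) (mfderiv 𝓘(ℝ, ℝ) 𝓘(ℝ, E) γ t (1 : ℝ)) := by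
    have := mvfderiv_comp_apply (f := γ) (g := k) t
      ((hk (γ t)).mdifferentiableAt one_ne_zero) hγt (1 : ℝ)
    rw [← this, mvfderiv, mfderiv_eq_fderiv]
    rfl
  rw [hder]
  exact enorm_le_iff_norm_le.2 (hle _ _)

variable [IsContMDiffRiemannianBundle 𝓘(ℝ, E) ∞ E (fun x : M ↦ TangentSpace 𝓘(ℝ, E) x)]
  {V : Type*} [NormedAddCommGroup V] [InnerProductSpace ℝ V] [FiniteDimensional ℝ V]
  {Φ : Diffeomorph 𝓘(ℝ, V) 𝓘(ℝ, E) V M ∞}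

/-- The ray to `Φ v` has length `‖v‖`. -/
theorem IsPolarDiffeo.riemannianEDist_le (h : IsPolarDiffeo Φ) (v : V) :
    riemannianEDist 𝓘(ℝ, E) (Φ 0) (Φ v) ≤ ENNReal.ofReal ‖v‖ := by
  refine (riemannianEDist_le_pathELength (γ := fun t : ℝ ↦ Φ (t • v)) (a := 0) (b := 1)
    (((h.isGeodesic v).contMDiff.of_le (by norm_cast)).contMDiffOn)
    (congrArg Φ (zero_smul ℝ v)) (congrArg Φ (one_smul ℝ v)) zero_le_one).trans_eq ?_
  rw [pathELength_eq_lintegral_mfderiv_Icc]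
  have hc (t : ℝ) : ‖mfderiv 𝓘(ℝ, ℝ) 𝓘(ℝ, E) (fun t : ℝ ↦ Φ (t • v)) t (1 : ℝ)‖ₑ =
      ENNReal.ofReal ‖v‖ := by
    have h1 := h.norm_frame_ray v t
    rw [← velocity_ray] at h1
    rw [← h1, ofReal_norm]
    rfl
  refine (MeasureTheory.lintegral_congr hc).trans ?_
  simp

theorem contMDiff_sqrt_norm_symm (Φ : Diffeomorph 𝓘(ℝ, V) 𝓘(ℝ, E) V M ∞) {ε : ℝ} (hε : 0 < ε) :
    ContMDiff 𝓘(ℝ, E) 𝓘(ℝ) 1 (fun x ↦ √(ε ^ 2 + ‖Φ.symm x‖ ^ 2)) := by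
  have h (v : V) : ε ^ 2 + ‖v‖ ^ 2 ≠ 0 := by positivity
  have h1 : ContDiff ℝ 1 fun v : V ↦ √(ε ^ 2 + ‖v‖ ^ 2) :=
    (contDiff_const.add (contDiff_norm_sq ℝ)).sqrt h
  exact h1.contMDiff.comp (Φ.symm.contMDiff.of_le (by norm_cast))

/-- By the Gauss lemma the smoothed norm `√(ε² + ‖exp⁻¹ x‖²)` has differential of norm at most
one. -/
theorem IsPolarDiffeo.norm_mvfderiv_sqrt_le (h : IsPolarDiffeo Φ) {ε : ℝ} (hε : 0 < ε) (x : M)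
    (u : TangentSpace 𝓘(ℝ, E) x) :
    ‖mvfderiv 𝓘(ℝ, E) (fun x ↦ √(ε ^ 2 + ‖Φ.symm x‖ ^ 2)) x u‖ ≤ ‖u‖ := by
  have hsmooth := contMDiff_sqrt_norm_symm Φ hε
  set k : M → ℝ := fun x ↦ √(ε ^ 2 + ‖Φ.symm x‖ ^ 2)
  have hpos (v : V) : 0 < ε ^ 2 + ‖v‖ ^ 2 := by positivity
  have hkΦ : k ∘ Φ = fun v ↦ √(ε ^ 2 + ‖v‖ ^ 2) := by
    ext v
    simp [k]
  obtain ⟨v, hv⟩ := Φ.surjective x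
  replace hv : Φ v = x := hv
  subst hv
  obtain ⟨w, rfl⟩ := exists_frame_eq Φ u
  have h1 := mvfderiv_pushField Φ ((hsmooth (Φ v)).mdifferentiableAt one_ne_zero) (fun _ ↦ w)
  have h2 := (((hasStrictFDerivAt_norm_sq v).hasFDerivAt.const_add (ε ^ 2)).sqrt (hpos v).ne').fderiv
  have hs : 0 < √(ε ^ 2 + ‖v‖ ^ 2) := Real.sqrt_pos.2 (hpos v)
  have h3 : mvfderiv 𝓘(ℝ, E) k (Φ v) (frame Φ w (Φ v)) =
      inner ℝ v w / √(ε ^ 2 + ‖v‖ ^ 2) := by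
    refine h1.trans ?_
    rw [hkΦ, h2]
    simp
    field_simp
  rw [h3, norm_div, Real.norm_of_nonneg hs.le, div_le_iff₀ hs, ← h.inner_radial_frame]
  calc _ ≤ ‖radial Φ (Φ v)‖ * ‖frame Φ w (Φ v)‖ := norm_inner_le_norm _ _
    _ ≤ √(ε ^ 2 + ‖v‖ ^ 2) * ‖frame Φ w (Φ v)‖ := by
      rw [h.norm_radial]
      gcongr
      exact Real.le_sqrt_of_sq_le (by linarith [sq_nonneg ε])
    _ = _ := mul_comm _ _

/-- The Riemannian distance from the pole, read in polar coordinates, is the norm. -/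
theorem IsPolarDiffeo.distFrom_eq (h : IsPolarDiffeo Φ) (v : V) :
    distFrom E (Φ 0) (Φ v) = ‖v‖ := by
  have hup := h.riemannianEDist_le v
  refine le_antisymm (ENNReal.toReal_le_of_le_ofReal (norm_nonneg v) hup) ?_
  refine le_of_forall_pos_le_add fun ε hε ↦ ?_
  have hlow := enorm_sub_le_riemannianEDist (contMDiff_sqrt_norm_symm Φ hε)
    (h.norm_mvfderiv_sqrt_le hε) (Φ 0) (Φ v)
  have h1 := ENNReal.toReal_mono (ne_top_of_le_ne_top ENNReal.ofReal_ne_top hup) hlow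
  rw [toReal_enorm] at h1
  simp only [Φ.symm_apply_apply] at h1
  have h2 : ‖v‖ ≤ √(ε ^ 2 + ‖v‖ ^ 2) := Real.le_sqrt_of_sq_le (by linarith [sq_nonneg ε])
  have h3 : √(ε ^ 2 + ‖(0 : V)‖ ^ 2) = ε := by simp [Real.sqrt_sq hε.le]
  rw [h3] at h1
  have h4 := (le_abs_self _).trans h1
  rw [distFrom]
  linarith

end Distance

/-! ### The Hessian of the distance -/

section Hessian

variable {E : Type*} [NormedAddCommGroup E] [NormedSpace ℝ E] [FiniteDimensional ℝ E]
  {M : Type*} [TopologicalSpace M] [ChartedSpace E M] [IsManifold 𝓘(ℝ, E) ∞ M]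
  [RiemannianBundle (fun x : M ↦ TangentSpace 𝓘(ℝ, E) x)]
  [IsContMDiffRiemannianBundle 𝓘(ℝ, E) ∞ E (fun x : M ↦ TangentSpace 𝓘(ℝ, E) x)]

/-- If the differential of `f` is represented near `x` by the field `G`, the Hessian of `f` is
`⟪∇_u G, u'⟫`. -/
theorem hessian_eq_inner_leviCivita {f : M → ℝ} {G : (x : M) → TangentSpace 𝓘(ℝ, E) x} {x : M}
    (hG : MDiffAt (T% G) x)
    (hf : ∀ᶠ y in nhds x, ∀ u : TangentSpace 𝓘(ℝ, E) y, mvfderiv 𝓘(ℝ, E) f y u = inner ℝ (G y) u)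
    (u u' : TangentSpace 𝓘(ℝ, E) x) :
    hessian f x u u' = inner ℝ (leviCivita E M G x u) u' := by
  have hu' : MDiffAt (T% (extend E u')) x := mdifferentiableAt_extend ..
  rw [hessian, hessianField, mvfderiv_congr (hf.mono fun y hy ↦ hy (extend E u' y)),
    mvfderiv_inner hG hu', hf.self_of_nhds, extend_apply_self, extend_apply_self]
  ring

variable {V : Type*} [NormedAddCommGroup V] [InnerProductSpace ℝ V] [FiniteDimensional ℝ V]
  {Φ : Diffeomorph 𝓘(ℝ, V) 𝓘(ℝ, E) V M ∞}

theorem IsPolarDiffeo.distFrom_comp (h : IsPolarDiffeo Φ) :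
    distFrom E (Φ 0) ∘ Φ = fun v ↦ ‖v‖ := funext h.distFrom_eq

theorem IsPolarDiffeo.contMDiffAt_distFrom (h : IsPolarDiffeo Φ) {v : V} (hv : v ≠ 0) :
    CMDiffAt ∞ (distFrom E (Φ 0)) (Φ v) := by
  refine contMDiffAt_of_comp_diffeo Φ le_rfl ?_
  rw [h.distFrom_comp]
  exact contDiffAt_norm ℝ hv

/-- The gradient of the distance from the pole is the normalized radial field. -/
theorem IsPolarDiffeo.mvfderiv_distFrom (h : IsPolarDiffeo Φ) {v : V} (hv : v ≠ 0)
    (u : TangentSpace 𝓘(ℝ, E) (Φ v)) : mvfderiv 𝓘(ℝ, E) (distFrom E (Φ 0)) (Φ v) u =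
      inner ℝ ((distFrom E (Φ 0) (Φ v))⁻¹ • radial Φ (Φ v)) u := by
  obtain ⟨w, rfl⟩ := exists_frame_eq Φ u
  have h1 := mvfderiv_pushField Φ ((h.contMDiffAt_distFrom hv).mdifferentiableAt (by simp))
    (fun _ ↦ w)
  refine h1.trans ?_
  rw [h.distFrom_comp, h.distFrom_eq, inner_smul_left, h.inner_radial_frame]
  have h2 : HasFDerivAt (fun v : V ↦ ‖v‖) (‖v‖⁻¹ • innerSL ℝ v) v := by
    have h3 := ((hasStrictFDerivAt_norm_sq v).hasFDerivAt.sqrt (by positivity))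
    simp only [Real.sqrt_sq (norm_nonneg _)] at h3
    refine h3.congr_fderiv ?_
    ext w
    simp
    field_simp
  rw [h2.fderiv]
  simp

/-- `Hess ρ = ρ⁻¹ (Hess (ρ²/2) - dρ ⊗ dρ)`, written in polar coordinates. -/
theorem IsPolarDiffeo.hessian_distFrom (h : IsPolarDiffeo Φ) {v : V} (hv : v ≠ 0) (w : V) :
    hessian (distFrom E (Φ 0)) (Φ v) (frame Φ w (Φ v)) (frame Φ w (Φ v)) =
      ‖v‖⁻¹ * (shape Φ v w w - ‖v‖⁻¹ ^ 2 * (inner ℝ v w) ^ 2) := by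
  have hρ := (h.contMDiffAt_distFrom hv).mdifferentiableAt (by simp)
  have hn : ‖v‖ ≠ 0 := norm_ne_zero_iff.2 hv
  have hinv : MDiffAt (fun y ↦ (distFrom E (Φ 0) y)⁻¹) (Φ v) := by
    refine (contMDiffAt_of_comp_diffeo Φ (n := 1) (by norm_cast) ?_).mdifferentiableAt one_ne_zero
    have : (fun y ↦ (distFrom E (Φ 0) y)⁻¹) ∘ Φ = fun v ↦ ‖v‖⁻¹ :=
      funext fun v ↦ congrArg _ (h.distFrom_eq v)
    rw [this]
    exact (contDiffAt_norm ℝ hv).inv hn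
  have hG : MDiffAt (T% ((fun y ↦ (distFrom E (Φ 0) y)⁻¹) • radial Φ)) (Φ v) :=
    hinv.smul_section (mdifferentiableAt_radial v)
  have hnear : ∀ᶠ y in nhds (Φ v), ∀ u : TangentSpace 𝓘(ℝ, E) y,
      mvfderiv 𝓘(ℝ, E) (distFrom E (Φ 0)) y u =
        inner ℝ (((fun y ↦ (distFrom E (Φ 0) y)⁻¹) • radial Φ) y) u := by
    have hne : ∀ᶠ y in nhds (Φ v), Φ.symm y ≠ 0 := by
      refine (Φ.symm.contMDiff.continuous.tendsto (Φ v)).eventually_ne ?_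
      rwa [Φ.symm_apply_apply]
    filter_upwards [hne] with y hy
    obtain ⟨v', hv'⟩ := Φ.surjective y
    replace hv' : Φ v' = y := hv'
    subst hv'
    rw [Φ.symm_apply_apply] at hy
    exact h.mvfderiv_distFrom hy
  have hinv' (u : TangentSpace 𝓘(ℝ, E) (Φ v)) :
      mvfderiv 𝓘(ℝ, E) (fun y ↦ (distFrom E (Φ 0) y)⁻¹) (Φ v) u =
        -(‖v‖⁻¹ ^ 2) * mvfderiv 𝓘(ℝ, E) (distFrom E (Φ 0)) (Φ v) u := by
    have hm := mvfderiv_fun_mul hρ hinv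
    have h1 : (fun y ↦ distFrom E (Φ 0) y * (distFrom E (Φ 0) y)⁻¹) =ᶠ[nhds (Φ v)] fun _ ↦ 1 := by
      have : distFrom E (Φ 0) (Φ v) ≠ 0 := by rwa [h.distFrom_eq]
      filter_upwards [hρ.continuousAt.eventually_ne this] with y hy using mul_inv_cancel₀ hy
    have hconst : mvfderiv 𝓘(ℝ, E) (fun _ : M ↦ (1 : ℝ)) (Φ v) u = 0 := by
      simp [mvfderiv]
    rw [mvfderiv_congr h1] at hm
    have h2 := DFunLike.congr_fun hm u
    rw [hconst] at h2
    simp only [h.distFrom_eq, add_apply, smul_apply, smul_eq_mul] at h2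
    generalize mvfderiv 𝓘(ℝ, E) (fun y ↦ (distFrom E (Φ 0) y)⁻¹) (Φ v) u = a at h2 ⊢
    rw [← mul_right_inj' hn]
    linear_combination (norm := (field_simp; ring)) -h2
  rw [hessian_eq_inner_leviCivita hG hnear]
  have hleib := DFunLike.congr_fun ((leviCivita E M).isCovariantDerivativeOnUniv.leibniz
    (mdifferentiableAt_radial (Φ := Φ) v) hinv (Set.mem_univ _)) (frame Φ w (Φ v))
  refine (congrArg (inner ℝ · (frame Φ w (Φ v))) hleib).trans ?_
  have hd := h.mvfderiv_distFrom hv (frame Φ w (Φ v))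
  rw [inner_smul_left, h.inner_radial_frame, h.distFrom_eq] at hd
  simp only [add_apply, smul_apply, ContinuousLinearMap.smulRight_apply, inner_add_left,
    inner_smul_left, h.inner_radial_frame, hinv', hd, h.distFrom_eq, shape_apply, conj_trivial]
  ring

/-- The Hessian comparison for the distance from the pole. The radial direction is in the kernel of
the Hessian, so only the component orthogonal to it contributes. -/
theorem IsPolarDiffeo.hessian_distFrom_le (h : IsPolarDiffeo Φ) {K : ℝ} (hK : 0 ≤ K)
    (hcurv : RadialCurvatureGE E (Φ 0) (-K ^ 2)) {v : V} (hv : v ≠ 0)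
    {u : TangentSpace 𝓘(ℝ, E) (Φ v)} (hu : ‖u‖ = 1) :
    hessian (distFrom E (Φ 0)) (Φ v) u u ≤ 1 / distFrom E (Φ 0) (Φ v) + K := by
  obtain ⟨w, rfl⟩ := exists_frame_eq Φ u
  have hr : 0 < ‖v‖ := norm_pos_iff.2 hv
  rw [h.hessian_distFrom hv, h.distFrom_eq]
  -- `w - c • v` is the component of `w` orthogonal to the ray
  let c : ℝ := ‖v‖⁻¹ ^ 2 * inner ℝ v w
  have hvv : shape Φ v v v = ‖v‖ ^ 2 := by
    rw [shape_apply, ← radial_apply, h.leviCivita_radial, h.inner_radial_radial]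
  have hvw : shape Φ v v w = inner ℝ v w := by
    rw [shape_apply, ← radial_apply, h.leviCivita_radial, h.inner_radial_frame]
  have hwv : shape Φ v w v = inner ℝ v w := by
    rw [← hvw, shape_apply, shape_apply, h.inner_leviCivita_radial_comm]
  have hgvv : gram Φ v v v = ‖v‖ ^ 2 := by
    rw [gram_apply, h.inner_frame_self]
  have hgvw : gram Φ v v w = inner ℝ v w := by
    rw [gram_apply, ← radial_apply, h.inner_radial_frame]
  have hgwv : gram Φ v w v = inner ℝ v w := by
    rw [gram_apply, real_inner_comm, ← gram_apply, hgvw]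
  have hgww : gram Φ v w w = 1 := by
    rw [gram_apply, real_inner_self_eq_norm_sq (frame Φ w (Φ v)), hu, one_pow]
  have hle := h.shape_le hK hcurv hv (w - c • v)
  simp only [map_sub, map_smul, sub_apply, smul_apply, smul_eq_mul, hvv, hvw, hwv, hgvv, hgvw,
    hgwv, hgww] at hle
  have hcv : c * ‖v‖ ^ 2 = inner ℝ v w := by
    simp only [c]
    field_simp
  have hcc : ‖v‖⁻¹ ^ 2 * (inner ℝ v w) ^ 2 = c * inner ℝ v w := by
    simp only [c]
    ring
  have hc0 : 0 ≤ c * inner ℝ v w := by rw [← hcc]; positivity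
  rw [hcc, inv_mul_le_iff₀ hr]
  have : ‖v‖ * (1 / ‖v‖ + K) = 1 + K * ‖v‖ := by field_simp
  rw [this]
  rw [hcv] at hle
  nlinarith [mul_nonneg (mul_nonneg hK hr.le) hc0]

end Hessian

end RiemannGeom

end

theorem theorem1p1
    {E : Type*} [NormedAddCommGroup E] [NormedSpace ℝ E] [FiniteDimensional ℝ E]
    {M : Type*} [TopologicalSpace M] [ChartedSpace E M] [IsManifold 𝓘(ℝ, E) ∞ M]
    [RiemannianBundle (fun x : M ↦ TangentSpace 𝓘(ℝ, E) x)]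
    [IsContMDiffRiemannianBundle 𝓘(ℝ, E) ∞ E (fun x : M ↦ TangentSpace 𝓘(ℝ, E) x)]
    (p : M) (hp : RiemannGeom.IsPole E p)
    (K : ℝ) (hK : 0 ≤ K) (hcurv : RiemannGeom.RadialCurvatureGE E p (-K ^ 2))
    (x : M) (hx : x ≠ p) :
    ContMDiffAt 𝓘(ℝ, E) 𝓘(ℝ) ∞ (RiemannGeom.distFrom E p) x ∧
      ∀ u : TangentSpace 𝓘(ℝ, E) x, ‖u‖ = 1 →
        RiemannGeom.hessian (RiemannGeom.distFrom E p) x u u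
          ≤ 1 / RiemannGeom.distFrom E p x + K := by
  obtain ⟨e, he⟩ := hp
  have : FiniteDimensional ℝ (TangentSpace 𝓘(ℝ, E) p) := inferInstanceAs (FiniteDimensional ℝ E)
  have h0 : e 0 = p := by
    have h1 := congrArg TotalSpace.proj (he 0).2
    exact (congrArg e (zero_smul ℝ _)).symm.trans h1
  have h : RiemannGeom.IsPolarDiffeo e :=
    { isGeodesic := fun v ↦ (he v).1
      norm_velocity := fun v ↦
        congrArg (fun q : TangentBundle 𝓘(ℝ, E) M ↦ ‖q.2‖) (he v).2 }
  obtain ⟨v, hv⟩ := e.surjective x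
  replace hv : e v = x := hv
  subst hv
  have hv0 : v ≠ 0 := by
    rintro rfl
    exact hx h0
  have h1 := h.contMDiffAt_distFrom hv0
  have h2 (u : TangentSpace 𝓘(ℝ, E) (e v)) := h.hessian_distFrom_le (u := u) hK (by rwa [h0]) hv0
  rw [h0] at h1 h2
  exact ⟨h1, h2⟩
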